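/- Let $1\le M\le N$ and let $\eta\in(\tfrac12,1)$ be the parameter in the LLL reduction condition (the classical choice is $\eta=\tfrac34$). Consider the channel $\mathbf y=\mathbf H\mathbf x+\mathbf w$, where $\mathbf x\in\mathbb Z[i]^M$ is the random transmitted vector (of arbitrary law), $\mathbf H\in\mathbb C^{N\times M}$ has i.i.d. circularly symmetric complex Gaussian entries of mean $0$ and variance $1$, $\mathbf w\in\mathbb C^N$ has i.i.d. circularly symmetric complex Gaussian entries of mean $0$ and variance $1/\rho$ ($\rho$ is the signal-to-noise ratio), and $\mathbf x,\mathbf H,\mathbf w$ are independent. For a matrix $\mathbf A$ of full column rank write $\mathbf A^{-1}=(\mathbf A^{\mathsf H}\mathbf A)^{-1}\mathbf A^{\mathsf H}$ (the inverse if $\mathbf A$ is square, the pseudo-inverse in general) and $\mathbf A^{-\mathsf H}=(\mathbf A^{-1})^{\mathsf H}$. A full-column-rank matrix $\mathbf B=[\mathbf b_1\dots\mathbf b_M]$ is called LLL-reduced if its Gram–Schmidt vectors $\mathbf b_i^*$ and coefficients $\mu_{i,j}=\langle \mathbf b_j^*,\mathbf b_i\rangle/\|\mathbf b_j^*\|^2$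 (inner product conjugate-linear in its first argument) satisfy $|\mu_{i,j}|^2\le\tfrac12$ for $j<i$ and $\eta\|\mathbf b_{i-1}^*\|^2\le\|\mathbf b_i^*+\mu_{i,i-1}\mathbf b_{i-1}^*\|^2$ for $2\le i\le M$. Two decoders are considered, each of which uses any measurable rule $\mathbf H\mapsto\mathbf U=\mathbf U(\mathbf H)$ that selects a matrix over $\mathbb Z[i]$, invertible over $\mathbb Z[i]$, with the stated property for every $\mathbf H$ of full column rank: - Type I: $\mathbf B=\mathbf H^{-\mathsf H}\mathbf U$ is LLL-reduced; with $\tilde{\mathbf x}$ the point of $\mathbb Z[i]^M$ closest to $\mathbf B^{\mathsf H}\mathbf y$, the decoder outputs $\hat{\mathbf x}=\mathbf U^{-\mathsf H}\tilde{\mathbf x}$. - Type II: $\mathbf H_{red}=\mathbf H\mathbf U$ is LLL-reduced; with $\tilde{\mathbf x}$ the point of $\mathbb Z[i]^M$ closest to $\mathbf H_{red}^{-1}\mathbf y$, the decoder outputs $\hat{\mathbf x}=\mathbf U\tilde{\mathbf x}$. Here ties in the choice of a closest point are broken by rounding real and imaginary parts that are half-integers upwards. Let $P_e=P_e(\rho)=\Pr\{\hat{\mathbf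 x}\ne\mathbf x\}$. Then, for each of the two types of decoder, $$\lim_{\rho\to\infty}\frac{-\log P_e}{\log\rho}=N .$$ Moreover there is a constant $C>0$ depending only on $M$, $N$ and $\eta$ such that, for each of the two types, $P_e\le C/\rho^N$ for all $\rho>0$ if $M<N$, and $P_e\le C(\ln\rho)^{N+1}/\rho^N$ for all $\rho>e$ if $M=N$. -/

import Mathlib

open scoped Matrix NNReal ENNReal

noncomputable section

namespace LLLDecoding

/-! ### Random channel and noise -/

/-- The circularly symmetric complex Gaussian law of mean zero and variance `v`: independent real
and imaginary parts, each of them centred Gaussian of variance `v / 2`. -/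
def complexGaussian (v : ℝ≥0) : MeasureTheory.Measure ℂ :=
  ((ProbabilityTheory.gaussianReal 0 (v / 2)).prod (ProbabilityTheory.gaussianReal 0 (v / 2))).map
    Complex.measurableEquivRealProd.symm

/-- Matrices carry the product (Borel) measurable structure of their entries. -/
instance instMeasurableSpaceMatrix (M N : ℕ) : MeasurableSpace (Matrix (Fin N) (Fin M) ℂ) :=
  inferInstanceAs (MeasurableSpace (Fin N → Fin M → ℂ))

/-- The law of the Rayleigh channel: an `N × M` matrix with i.i.d. entries of zero mean and unit
variance. -/
def channelLaw (M N : ℕ) : MeasureTheory.Measure (Matrix (Fin N) (Fin M) ℂ) :=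
  MeasureTheory.Measure.pi fun _ : Fin N =>
    MeasureTheory.Measure.pi fun _ : Fin M => complexGaussian 1

/-- The law of the noise at signal-to-noise ratio `ρ`: `N` i.i.d. complex Gaussian entries of
zero mean and variance `σ² = 1 / ρ`. -/
def noiseLaw (N : ℕ) (ρ : ℝ) : MeasureTheory.Measure (Fin N → ℂ) :=
  MeasureTheory.Measure.pi fun _ : Fin N => complexGaussian (1 / ρ).toNNReal

/-! ### Gaussian integers -/

/-- A matrix of Gaussian integers, read as a complex matrix. -/
def toComplexMatrix {M : ℕ} (U : Matrix (Fin M) (Fin M) GaussianInt) :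
    Matrix (Fin M) (Fin M) ℂ :=
  U.map GaussianInt.toComplex

/-- A vector of Gaussian integers, read as a complex vector. -/
def toComplexVec {M : ℕ} (x : Fin M → GaussianInt) : Fin M → ℂ :=
  fun j => GaussianInt.toComplex (x j)

/-- The closest integer point: every coordinate is replaced by a nearest Gaussian integer, that is,
its real and imaginary parts are rounded to a nearest integer. -/
def nearestPoint {M : ℕ} (z : Fin M → ℂ) : Fin M → GaussianInt :=
  fun j => ⟨round (z j).re, round (z j).im⟩

/-! ### LLL-reduced bases -/

/-- The `j`-th column of a matrix, as a vector of the Euclidean space `ℂᴺ`. -/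
def column {M N : ℕ} (B : Matrix (Fin N) (Fin M) ℂ) (j : Fin M) : EuclideanSpace ℂ (Fin N) :=
  WithLp.toLp 2 (fun i => B i j)

/-- The Gram–Schmidt vectors (orthogonal, not normalized) of the columns of `B`. -/
def gsVec {M N : ℕ} (B : Matrix (Fin N) (Fin M) ℂ) : Fin M → EuclideanSpace ℂ (Fin N) :=
  InnerProductSpace.gramSchmidt ℂ (column B)

/-- The Gram–Schmidt coefficient `μ i j` of the `i`-th column of `B` along the `j`-th
Gram–Schmidt vector. -/
def gsCoeff {M N : ℕ} (B : Matrix (Fin N) (Fin M) ℂ) (i j : Fin M) : ℂ :=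
  inner ℂ (gsVec B j) (column B i) / (‖gsVec B j‖ : ℂ) ^ 2

/-- The columns of `B` form an LLL-reduced basis (with parameter `η`) of the lattice that they
generate over the Gaussian integers: they are linearly independent, size-reduced, and satisfy the
Lovász condition. Size reduction is the condition `|μ i j|² ≤ 1 / 2`, which holds in particular
when the real and imaginary parts of `μ i j` are at most `1 / 2` in absolute value. -/
structure IsLLLReduced {M N : ℕ} (η : ℝ) (B : Matrix (Fin N) (Fin M) ℂ) : Prop where
  linearIndependent : LinearIndependent ℂ (column B)
  size_reduced : ∀ i j : Fin M, j < i → ‖gsCoeff B i j‖ ^ 2 ≤ 1 / 2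
  lovasz : ∀ i j : Fin M, (j : ℕ) + 1 = (i : ℕ) →
    η * ‖gsVec B j‖ ^ 2 ≤ ‖gsVec B i + gsCoeff B i j • gsVec B j‖ ^ 2

/-- `U` is an LLL reduction rule for the basis `G H` computed from the channel matrix `H`: a
measurable choice, for each `H`, of a unimodular matrix `U H` over the Gaussian integers such that
`G H * U H` is LLL-reduced whenever `H` has full column rank (which holds almost surely). -/
structure IsLLLReduction {M N : ℕ} (η : ℝ)
    (G : Matrix (Fin N) (Fin M) ℂ → Matrix (Fin N) (Fin M) ℂ)
    (U : Matrix (Fin N) (Fin M) ℂ → GL (Fin M) GaussianInt) : Prop where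
  measurable : ∀ V : GL (Fin M) GaussianInt, MeasurableSet {H | U H = V}
  reduced : ∀ H : Matrix (Fin N) (Fin M) ℂ, LinearIndependent ℂ (column H) →
    IsLLLReduced η (G H * toComplexMatrix (U H).val)

/-! ### The two decoders -/

/-- The pseudo-inverse `(Hᴴ H)⁻¹ Hᴴ` of a matrix of full column rank; it is the inverse when the
matrix is square. -/
def pinv {M N : ℕ} (H : Matrix (Fin N) (Fin M) ℂ) : Matrix (Fin M) (Fin N) ℂ :=
  (Hᴴ * H)⁻¹ * Hᴴ

/-- The matrix `H^{-H}`: the Hermitian of the (pseudo-)inverse of `H`. -/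
def invHerm {M N : ℕ} (H : Matrix (Fin N) (Fin M) ℂ) : Matrix (Fin N) (Fin M) ℂ :=
  (pinv H)ᴴ

/-- Type I decoding: with `B = H^{-H} U`, round `Bᴴ y` to the closest integer point and multiply by
`U^{-H}`. -/
def decodeI {M N : ℕ} (U : Matrix (Fin N) (Fin M) ℂ → GL (Fin M) GaussianInt)
    (H : Matrix (Fin N) (Fin M) ℂ) (y : Fin N → ℂ) : Fin M → GaussianInt :=
  ((U H).valᴴ)⁻¹ *ᵥ nearestPoint ((invHerm H * toComplexMatrix (U H).val)ᴴ *ᵥ y)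

/-- Type II decoding: with `H_red = H U`, round `H_red⁻¹ y` to the closest integer point and
multiply by `U`. -/
def decodeII {M N : ℕ} (U : Matrix (Fin N) (Fin M) ℂ → GL (Fin M) GaussianInt)
    (H : Matrix (Fin N) (Fin M) ℂ) (y : Fin N → ℂ) : Fin M → GaussianInt :=
  (U H).val *ᵥ nearestPoint (pinv (H * toComplexMatrix (U H).val) *ᵥ y)

/-! ### Error probability -/

/-- The error probability of a decoder `dec` at signal-to-noise ratio `ρ`, when the transmitted
vector `x` has law `p`, the channel `H` and the noise `w` are random as above, and `x`, `H`, `w`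
are independent: the probability that `dec H (H x + w) ≠ x`. -/
def errorProb {M N : ℕ} (p : PMF (Fin M → GaussianInt))
    (dec : Matrix (Fin N) (Fin M) ℂ → (Fin N → ℂ) → (Fin M → GaussianInt)) (ρ : ℝ) : ℝ :=
  (∑' x : Fin M → GaussianInt,
    p x * ((channelLaw M N).prod (noiseLaw N ρ))
      {Hw | dec Hw.1 (Hw.1 *ᵥ toComplexVec x + Hw.2) ≠ x}).toReal

/-- The function `P` of the signal-to-noise ratio `ρ` has diversity `d`. -/
def HasDiversity (P : ℝ → ℝ) (d : ℝ) : Prop :=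
  Filter.Tendsto (fun ρ : ℝ => -Real.log (P ρ) / Real.log ρ) Filter.atTop (nhds d)

end LLLDecoding

end

/-!
Both decoders apply an equalizer `V H⁻¹` with `V` unimodular over the Gaussian integers (`V = Uᴴ`
for type I, `V = U⁻¹` for type II), round, and undo the change of basis. Rounding commutes with
translation by Gaussian integers, so decoding fails exactly when the filtered noise `V H⁻¹ w` is not
rounded to zero; this does not depend on the transmitted vector (`inv_mulVec_nearestPoint_eq_iff`,
`IsReducedRounding.errorProb_eq`).

*Upper bound.* A basis that is LLL-reduced and its dual basis satisfy `‖bᵢ‖ ‖aᵢ‖ ≤ D` with `D`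
depending only on `M` and `η` (`norm_column_mul_norm_dual_le`). Here the rows of `V H⁻¹` and the
columns of `H V⁻¹` are dual to each other and one of the two bases is reduced. A rounding error
means `‖w‖ ≥ const / ‖bᵢ‖` for some row `bᵢ`, hence the nonzero vector `aᵢ` of the lattice generated
by `H` has length at most `const ‖w‖` (`exists_short_of_nearestPoint_ne_zero`). It remains to
estimate the probability that a random lattice has a nonzero vector of length at most `r`. For a
fixed vector `z` of Gaussian integers the probability of `‖H z‖ ≤ r` is at most of order `(r / ‖z‖) ^ (2N)`, and there
are about `2 ^ (2Mm)` vectors `z` of size about `2 ^ m`. For `M < N` the sum over `m` is a geometric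
series and gives `r ^ (2N)` (`channelLaw_exists_short_le_of_lt`). For `M = N` each `m` contributes
equally; the sum is stopped at `m = L`, and vectors `z` beyond that are excluded because they would
bring one column of `H` within distance `r / 2 ^ L` of the span of the others
(`channelLaw_exists_mulVec_norm_le`), which yields `L r ^ (2N) + r ^ 2 / 4 ^ L`. Averaging over the
noise replaces `r ^ (2k)` by a multiple of `ρ ^ (-k)`, and `L ≈ N log ρ` is a suitable choice.

*Lower bound.* With probability of order `ρ ^ (-N)` the entries of a column `h` of `H` are at most a
small multiple of `ρ ^ (-1/2)`. As `V H⁻¹ h` is a nonzero vector of Gaussian integers, some entry of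
`V H⁻¹` is then at least a large multiple of `ρ ^ (1/2)`, and the filtered noise is rounded to a
nonzero vector with probability at least `1/2` (`exists_lower_bound`).

All probability estimates come from one anticoncentration bound for linear forms in independent
complex Gaussian variables, `pi_complexGaussian_linear_le`.
-/

noncomputable section

namespace LLLDecoding

/-! ### Duals of LLL-reduced bases -/

section Dual

variable {M N : ℕ} {η : ℝ} {B : Matrix (Fin N) (Fin M) ℂ}

/-- A bound for `‖bᵢ‖ ‖aᵢ‖`, where the `bᵢ` are an LLL-reduced basis and the `aᵢ` its dual basis. -/
def dualConst (M : ℕ) (η : ℝ) : ℝ := M ^ 2 * 2 ^ M * (1 / (η - 1 / 2)) ^ M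

lemma dualConst_nonneg (M : ℕ) (hη : 1 / 2 < η) : 0 ≤ dualConst M η := by
  have : 0 < η - 1 / 2 := by linarith
  unfold dualConst
  positivity

lemma column_eq_gsVec_add (B : Matrix (Fin N) (Fin M) ℂ) (i : Fin M) :
    column B i = gsVec B i + ∑ j ∈ Finset.Iio i, gsCoeff B i j • gsVec B j :=
  InnerProductSpace.gramSchmidt_def'' ℂ (column B) i

lemma norm_gsCoeff_le_one (h : IsLLLReduced η B) {i j : Fin M} (hij : j < i) :
    ‖gsCoeff B i j‖ ≤ 1 := by
  have := h.size_reduced i j hij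
  nlinarith [norm_nonneg (gsCoeff B i j)]

lemma norm_gsVec_sq_le_succ (h : IsLLLReduced η B) {i j : Fin M} (hij : (j : ℕ) + 1 = i) :
    (η - 1 / 2) * ‖gsVec B j‖ ^ 2 ≤ ‖gsVec B i‖ ^ 2 := by
  have hlt : j < i := by rw [Fin.lt_def]; omega
  have h1 := h.lovasz i j hij
  have h2 := h.size_reduced i j hlt
  have h0 : inner ℂ (gsVec B i) (gsCoeff B i j • gsVec B j) = 0 := by
    rw [inner_smul_right]
    have : inner ℂ (gsVec B i) (gsVec B j) = 0 :=
      InnerProductSpace.gramSchmidt_orthogonal ℂ (column B) hlt.ne'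
    rw [this, mul_zero]
  have h3 := norm_add_sq_eq_norm_sq_add_norm_sq_of_inner_eq_zero _ _ h0
  rw [norm_smul] at h3
  nlinarith [sq_nonneg ‖gsVec B j‖]

lemma norm_gsVec_sq_le (h : IsLLLReduced η B) (hη : 1 / 2 < η) (hη' : η < 1) {i j : Fin M}
    (hij : j ≤ i) : ‖gsVec B j‖ ^ 2 ≤ (1 / (η - 1 / 2)) ^ M * ‖gsVec B i‖ ^ 2 := by
  have hpos : 0 < η - 1 / 2 := by linarith
  have hβ : 1 ≤ 1 / (η - 1 / 2) := by rw [le_div_iff₀ hpos]; linarith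
  have key : ∀ d : ℕ, ∀ i : Fin M, (j : ℕ) + d = i →
      ‖gsVec B j‖ ^ 2 ≤ (1 / (η - 1 / 2)) ^ d * ‖gsVec B i‖ ^ 2 := by
    intro d
    induction d with
    | zero =>
      intro i hi
      have : j = i := Fin.ext (by simpa using hi)
      simp [this]
    | succ d ih =>
      intro i hi
      have hk : (j : ℕ) + d < M := by have := i.2; omega
      have h1 := ih ⟨j + d, hk⟩ rfl
      have h2 := norm_gsVec_sq_le_succ h (i := i) (j := ⟨j + d, hk⟩) (by simp; omega)
      have h3 : ‖gsVec B ⟨j + d, hk⟩‖ ^ 2 ≤ 1 / (η - 1 / 2) * ‖gsVec B i‖ ^ 2 := by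
        rw [one_div, ← div_eq_inv_mul, le_div_iff₀ hpos]; linarith
      calc _ ≤ _ := h1
        _ ≤ (1 / (η - 1 / 2)) ^ d * (1 / (η - 1 / 2) * ‖gsVec B i‖ ^ 2) := by gcongr
        _ = _ := by ring
  obtain ⟨d, hd⟩ := Nat.exists_eq_add_of_le (Fin.le_def.1 hij)
  refine (key d i hd.symm).trans ?_
  have : d ≤ M := by have := i.2; omega
  gcongr

/-- The coefficients of a dual vector along the Gram–Schmidt vectors solve a unitriangular system
with coefficients at most `1`. -/
lemma norm_inner_gsVec_le (h : IsLLLReduced η B) {i : Fin M} {a : EuclideanSpace ℂ (Fin N)}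
    (ha : ∀ j, inner ℂ (column B j) a = if j = i then 1 else 0) (k : Fin M) :
    (k < i → inner ℂ (gsVec B k) a = 0) ∧ ‖inner ℂ (gsVec B k) a‖ ≤ 2 ^ (k : ℕ) := by
  induction k using WellFoundedLT.induction with
  | ind k ih =>
    have hk : inner ℂ (gsVec B k) a = (if k = i then 1 else 0) -
        ∑ j ∈ Finset.Iio k, star (gsCoeff B k j) * inner ℂ (gsVec B j) a := by
      rw [← ha k, column_eq_gsVec_add B k, inner_add_left, sum_inner]
      simp [inner_smul_left]
    constructor
    · intro hki
      rw [hk, if_neg hki.ne, Finset.sum_eq_zero, sub_zero]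
      intro j hj
      have hj' := Finset.mem_Iio.1 hj
      rw [(ih j hj').1 (hj'.trans hki), mul_zero]
    · have hsum : ∑ j ∈ Finset.Iio k, (2 : ℝ) ^ (j : ℕ) = 2 ^ (k : ℕ) - 1 := by
        have : ∑ j ∈ Finset.Iio k, (2 : ℝ) ^ (j : ℕ) = ∑ j ∈ Finset.range k, (2 : ℝ) ^ j := by
          rw [← Nat.Iio_eq_range, ← Fin.map_valEmbedding_Iio, Finset.sum_map]
          rfl
        rw [this, geom_sum_eq (by norm_num)]; norm_num
      rw [hk]
      calc _ ≤ ‖(if k = i then 1 else 0 : ℂ)‖ +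
            ‖∑ j ∈ Finset.Iio k, star (gsCoeff B k j) * inner ℂ (gsVec B j) a‖ := norm_sub_le _ _
        _ ≤ 1 + ∑ j ∈ Finset.Iio k, (2 : ℝ) ^ (j : ℕ) := by
            gcongr
            · split_ifs <;> simp
            · refine (norm_sum_le _ _).trans (Finset.sum_le_sum fun j hj => ?_)
              have hj' := Finset.mem_Iio.1 hj
              rw [norm_mul, norm_star]
              calc _ ≤ 1 * (2 : ℝ) ^ (j : ℕ) := by
                    gcongr
                    · exact norm_gsCoeff_le_one h hj'
                    · exact (ih j hj').2
                _ = _ := one_mul _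
        _ = _ := by rw [hsum]; ring

/-- In an LLL-reduced basis the Gram–Schmidt norms decrease at most geometrically. Hence `‖bᵢ‖` is
at most a multiple of `‖bᵢ*‖`, while the dual vector `aᵢ`, whose components along `bₖ*` vanish for
`k < i`, has norm at most a multiple of `1 / ‖bᵢ*‖`. -/
theorem norm_column_mul_norm_dual_le (h : IsLLLReduced η B) (hη : 1 / 2 < η) (hη' : η < 1)
    {i : Fin M} {a : EuclideanSpace ℂ (Fin N)}
    (ha_span : a ∈ Submodule.span ℂ (Set.range (column B)))
    (ha : ∀ j, inner ℂ (column B j) a = if j = i then 1 else 0) :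
    ‖column B i‖ * ‖a‖ ≤ dualConst M η := by
  have hpos : 0 < η - 1 / 2 := by linarith
  set K : ℝ := Real.sqrt ((1 / (η - 1 / 2)) ^ M) with hK
  have hKsq : K ^ 2 = (1 / (η - 1 / 2)) ^ M := Real.sq_sqrt (by positivity)
  have hK0 : 0 ≤ K := Real.sqrt_nonneg _
  have hgs : ∀ {i j : Fin M}, j ≤ i → ‖gsVec B j‖ ≤ K * ‖gsVec B i‖ := by
    intro i j hij
    refine le_of_sq_le_sq ?_ (by positivity)
    rw [mul_pow, hKsq]
    exact norm_gsVec_sq_le h hη hη' hij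
  have hne : ∀ j, 0 < ‖gsVec B j‖ := fun j => norm_pos_iff.2
    (InnerProductSpace.gramSchmidt_ne_zero j h.linearIndependent)
  have hb : ‖column B i‖ ≤ M * (K * ‖gsVec B i‖) := by
    have h1 : column B i = ∑ j ∈ Finset.Iic i,
        (if j = i then 1 else gsCoeff B i j) • gsVec B j := by
      rw [column_eq_gsVec_add B i, ← Finset.Iio_insert, Finset.sum_insert (by simp)]
      simp only [if_true, one_smul]
      congr 1
      refine Finset.sum_congr rfl fun j hj => ?_
      rw [if_neg (Finset.mem_Iio.1 hj).ne]
    rw [h1]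
    calc _ ≤ ∑ j ∈ Finset.Iic i, ‖(if j = i then 1 else gsCoeff B i j) • gsVec B j‖ :=
          norm_sum_le _ _
      _ ≤ ∑ j ∈ Finset.Iic i, K * ‖gsVec B i‖ := by
          refine Finset.sum_le_sum fun j hj => ?_
          rw [norm_smul]
          have hj' := Finset.mem_Iic.1 hj
          calc _ ≤ 1 * (K * ‖gsVec B i‖) := by
                gcongr
                · split_ifs with hji
                  · simp
                  · exact norm_gsCoeff_le_one h (lt_of_le_of_ne hj' hji)
                · exact hgs hj'
            _ = _ := one_mul _
      _ ≤ ∑ j : Fin M, K * ‖gsVec B i‖ :=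
          Finset.sum_le_sum_of_subset_of_nonneg (Finset.subset_univ _) fun _ _ _ => by positivity
      _ = _ := by simp
  have hspan : a ∈ Submodule.span ℂ (Set.range (gsVec B)) := by
    rwa [gsVec, InnerProductSpace.span_gramSchmidt]
  obtain ⟨c, hc⟩ := (Submodule.mem_span_range_iff_exists_fun ℂ).1 hspan
  have hcoef : ∀ k, inner ℂ (gsVec B k) a = c k * (‖gsVec B k‖ : ℂ) ^ 2 := by
    intro k
    rw [← hc, inner_sum, Finset.sum_eq_single k]
    · rw [inner_smul_right, inner_self_eq_norm_sq_to_K]; rfl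
    · intro j _ hjk
      have : inner ℂ (gsVec B k) (gsVec B j) = 0 :=
        InnerProductSpace.gramSchmidt_orthogonal ℂ (column B) hjk.symm
      rw [inner_smul_right, this, mul_zero]
    · simp
  have ha' : ‖a‖ ≤ M * (2 ^ M * (K / ‖gsVec B i‖)) := by
    rw [← hc]
    calc _ ≤ ∑ k, ‖c k • gsVec B k‖ := norm_sum_le _ _
      _ ≤ ∑ k : Fin M, 2 ^ M * (K / ‖gsVec B i‖) := by
          refine Finset.sum_le_sum fun k _ => ?_
          obtain ⟨hz, hle⟩ := norm_inner_gsVec_le h ha k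
          rw [norm_smul]
          have hck := congrArg norm (hcoef k)
          rw [norm_mul, norm_pow, Complex.norm_real, norm_norm] at hck
          have hk := hne k
          have hi := hne i
          rcases lt_or_ge k i with hki | hki
          · have : ‖c k‖ = 0 := by
              rw [hz hki, norm_zero] at hck
              rcases mul_eq_zero.1 hck.symm with h' | h'
              · exact h'
              · exact absurd h' (by positivity)
            rw [this, zero_mul]
            positivity
          · have h1 : ‖c k‖ * ‖gsVec B k‖ ≤ 2 ^ (k : ℕ) / ‖gsVec B k‖ := by
              rw [le_div_iff₀ hk]; linarith [hck, sq (‖gsVec B k‖)]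
            have h2 : 1 / ‖gsVec B k‖ ≤ K / ‖gsVec B i‖ := by
              rw [div_le_div_iff₀ hk hi]; linarith [hgs hki]
            calc _ ≤ (2 : ℝ) ^ (k : ℕ) / ‖gsVec B k‖ := h1
              _ = 2 ^ (k : ℕ) * (1 / ‖gsVec B k‖) := by ring
              _ ≤ 2 ^ M * (K / ‖gsVec B i‖) := by
                gcongr
                · norm_num
                · exact k.2.le
      _ = _ := by simp
  calc _ ≤ (M * (K * ‖gsVec B i‖)) * (M * (2 ^ M * (K / ‖gsVec B i‖))) := by gcongr
    _ = M ^ 2 * 2 ^ M * K ^ 2 := by field_simp [(hne i).ne']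
    _ = _ := by rw [hKsq]; rfl

end Dual

/-! ### Small-ball estimates for complex Gaussian vectors -/

section SmallBall

open MeasureTheory ProbabilityTheory

instance isProbabilityMeasure_complexGaussian (v : ℝ≥0) :
    IsProbabilityMeasure (complexGaussian v) := by
  unfold complexGaussian
  exact Measure.isProbabilityMeasure_map (by fun_prop)

instance isProbabilityMeasure_noiseLaw (N : ℕ) (ρ : ℝ) : IsProbabilityMeasure (noiseLaw N ρ) := by
  unfold noiseLaw; infer_instance

instance isProbabilityMeasure_channelLaw (M N : ℕ) : IsProbabilityMeasure (channelLaw M N) :=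
  inferInstanceAs (IsProbabilityMeasure (Measure.pi fun _ : Fin N =>
    Measure.pi fun _ : Fin M => complexGaussian 1))

lemma complexGaussian_reProdIm (v : ℝ≥0) (s t : Set ℝ) :
    complexGaussian v (s ×ℂ t) = gaussianReal 0 (v / 2) s * gaussianReal 0 (v / 2) t := by
  unfold complexGaussian
  rw [MeasurableEquiv.map_apply, ← Measure.prod_prod]
  congr 1

lemma gaussianReal_Icc_le {v : ℝ≥0} (hv : v ≠ 0) (m x s : ℝ) :
    gaussianReal m v (Set.Icc (x - s) (x + s)) ≤
      ENNReal.ofReal ((Real.sqrt (2 * Real.pi * v))⁻¹ * (2 * s)) := by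
  rw [gaussianReal_apply _ hv]
  calc _ ≤ ∫⁻ _ in Set.Icc (x - s) (x + s), ENNReal.ofReal (Real.sqrt (2 * Real.pi * v))⁻¹ := by
        refine lintegral_mono fun y => ENNReal.ofReal_le_ofReal ?_
        rw [gaussianPDFReal_def]
        refine mul_le_of_le_one_right (by positivity) (Real.exp_le_one_iff.2 ?_)
        exact div_nonpos_of_nonpos_of_nonneg (by nlinarith [sq_nonneg (y - m)]) (by positivity)
    _ = _ := by
        rw [setLIntegral_const, Real.volume_Icc, ← ENNReal.ofReal_mul (by positivity)]
        congr 2; ring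

lemma le_gaussianReal_Icc {v : ℝ≥0} (hv : v ≠ 0) (s : ℝ) :
    ENNReal.ofReal ((Real.sqrt (2 * Real.pi * v))⁻¹ * Real.exp (-s ^ 2 / (2 * v)) * (2 * s)) ≤
      gaussianReal 0 v (Set.Icc (-s) s) := by
  rw [gaussianReal_apply _ hv]
  calc _ = ∫⁻ _ in Set.Icc (-s) s,
        ENNReal.ofReal ((Real.sqrt (2 * Real.pi * v))⁻¹ * Real.exp (-s ^ 2 / (2 * v))) := by
        rw [setLIntegral_const, Real.volume_Icc, ← ENNReal.ofReal_mul (by positivity)]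
        congr 2; ring
    _ ≤ _ := by
        refine setLIntegral_mono (by fun_prop) fun y hy => ENNReal.ofReal_le_ofReal ?_
        rw [gaussianPDFReal_def]
        have : y ^ 2 ≤ s ^ 2 := sq_le_sq' hy.1 hy.2
        simp only [sub_zero]
        gcongr

/-- The density of `complexGaussian v` is at most `1 / (π v)`. -/
lemma complexGaussian_affine_ball_le {v : ℝ≥0} (hv : v ≠ 0) {a : ℂ} (ha : a ≠ 0) (b : ℂ) {r : ℝ}
    (hr : 0 ≤ r) :
    complexGaussian v {z | ‖a * z + b‖ ≤ r} ≤ ENNReal.ofReal (2 * r ^ 2 / (v * ‖a‖ ^ 2)) := by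
  have ha' : 0 < ‖a‖ := norm_pos_iff.2 ha
  set c : ℂ := -b / a
  set s : ℝ := r / ‖a‖
  have hv2 : v / 2 ≠ 0 := by positivity
  have hvpos : (0 : ℝ) < v := by positivity
  have hsub : {z | ‖a * z + b‖ ≤ r} ⊆
      Set.Icc (c.re - s) (c.re + s) ×ℂ Set.Icc (c.im - s) (c.im + s) := by
    intro z hz
    have hz' : ‖z - c‖ ≤ s := by
      rw [le_div_iff₀ ha', ← norm_mul]
      have : (z - c) * a = a * z + b := by simp only [c]; field_simp; ring
      rwa [this]
    have h1 := abs_le.1 ((Complex.abs_re_le_norm (z - c)).trans hz')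
    have h2 := abs_le.1 ((Complex.abs_im_le_norm (z - c)).trans hz')
    rw [Complex.sub_re] at h1
    rw [Complex.sub_im] at h2
    rw [Complex.mem_reProdIm]
    exact ⟨⟨by linarith, by linarith⟩, ⟨by linarith, by linarith⟩⟩
  refine (measure_mono hsub).trans ?_
  rw [complexGaussian_reProdIm]
  refine (mul_le_mul' (gaussianReal_Icc_le hv2 _ _ _) (gaussianReal_Icc_le hv2 _ _ _)).trans ?_
  rw [← ENNReal.ofReal_mul (by positivity)]
  refine ENNReal.ofReal_le_ofReal ?_
  have hc : (2 * Real.pi * ((v / 2 : ℝ≥0) : ℝ)) = Real.pi * v := by push_cast; ring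
  rw [hc]
  have hsq : (Real.sqrt (Real.pi * v))⁻¹ * (Real.sqrt (Real.pi * v))⁻¹ = 1 / (Real.pi * v) := by
    rw [← mul_inv, Real.mul_self_sqrt (by positivity), one_div]
  calc _ = (Real.sqrt (Real.pi * v))⁻¹ * (Real.sqrt (Real.pi * v))⁻¹ * (4 * s ^ 2) := by ring
    _ = (4 / Real.pi) * (s ^ 2 / v) := by rw [hsq]; field_simp
    _ ≤ 2 * (s ^ 2 / v) := by
        gcongr
        rw [div_le_iff₀ Real.pi_pos]; linarith [Real.pi_gt_three]
    _ = _ := by simp only [s]; field_simp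

/-- Anticoncentration of a linear form in independent complex Gaussian variables: conditioning on
the other coordinates, one coordinate with a nonzero coefficient suffices. -/
lemma pi_complexGaussian_linear_le {n : ℕ} {v : ℝ≥0} (hv : v ≠ 0) (a : Fin n → ℂ) {j : Fin n}
    (ha : a j ≠ 0) {r : ℝ} (hr : 0 ≤ r) :
    Measure.pi (fun _ : Fin n => complexGaussian v) {h | ‖∑ k, h k * a k‖ ≤ r} ≤
      ENNReal.ofReal (2 * r ^ 2 / (v * ‖a j‖ ^ 2)) := by
  obtain _ | n := n
  · exact j.elim0
  have hmp := (measurePreserving_piFinSuccAbove (fun _ : Fin (n + 1) => complexGaussian v) j).symm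
  have hmeas : MeasurableSet {h : Fin (n + 1) → ℂ | ‖∑ k, h k * a k‖ ≤ r} :=
    measurableSet_le (by fun_prop) measurable_const
  rw [← hmp.measure_preimage hmeas.nullMeasurableSet,
    Measure.prod_apply_symm (hmp.measurable hmeas)]
  refine (lintegral_mono (g := fun _ => ENNReal.ofReal (2 * r ^ 2 / (v * ‖a j‖ ^ 2)))
    fun y => ?_).trans (by simp)
  refine le_trans (measure_mono ?_)
    (complexGaussian_affine_ball_le hv ha (∑ k, y k * a (j.succAbove k)) hr)
  intro z hz
  simp only [Set.mem_preimage, Set.mem_ofPred_eq, MeasurableEquiv.piFinSuccAbove_symm_apply] at hz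
  rw [Fin.sum_univ_succAbove _ j] at hz
  simpa [Fin.insertNthEquiv, mul_comm (a j)] using hz

/-- The complex Gaussian law gives a centred square of half-side `s ≤ 1` mass of order `s²`. -/
lemma exists_le_complexGaussian_ball : ∃ c : ℝ, 0 < c ∧ ∀ s : ℝ, 0 ≤ s → s ≤ 1 →
    ENNReal.ofReal (c * s ^ 2) ≤ complexGaussian 1 {z | ‖z‖ ≤ 2 * s} := by
  set d : ℝ := (Real.sqrt (2 * Real.pi * ((1 / 2 : ℝ≥0) : ℝ)))⁻¹ *
    Real.exp (-1 / (2 * ((1 / 2 : ℝ≥0) : ℝ))) * 2 with hd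
  have hd0 : 0 < d := by
    have := Real.pi_pos
    positivity
  refine ⟨d ^ 2, by positivity, fun s hs hs1 => ?_⟩
  have hsub : Set.Icc (-s) s ×ℂ Set.Icc (-s) s ⊆ {z : ℂ | ‖z‖ ≤ 2 * s} := by
    intro z hz
    rw [Complex.mem_reProdIm] at hz
    have h1 := abs_le.2 hz.1
    have h2 := abs_le.2 hz.2
    have := Complex.norm_le_abs_re_add_abs_im z
    simp only [Set.mem_ofPred_eq]
    linarith
  refine le_trans ?_ (measure_mono hsub)
  rw [complexGaussian_reProdIm]
  have hle : ENNReal.ofReal (d * s) ≤ gaussianReal 0 (1 / 2) (Set.Icc (-s) s) := by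
    refine le_trans (ENNReal.ofReal_le_ofReal ?_) (le_gaussianReal_Icc (by positivity) s)
    have h1 : s ^ 2 ≤ 1 := pow_le_one₀ hs hs1
    calc d * s = (Real.sqrt (2 * Real.pi * ((1 / 2 : ℝ≥0) : ℝ)))⁻¹ *
          Real.exp (-1 / (2 * ((1 / 2 : ℝ≥0) : ℝ))) * (2 * s) := by rw [hd]; ring
      _ ≤ _ := by gcongr
  calc _ = ENNReal.ofReal (d * s) * ENNReal.ofReal (d * s) := by
        rw [← ENNReal.ofReal_mul (by positivity)]; congr 1; ring
    _ ≤ _ := mul_le_mul' hle hle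

end SmallBall

/-! ### Short vectors of a random lattice -/

section ShortVectors

open MeasureTheory ProbabilityTheory

variable {M N : ℕ}

lemma channelLaw_mulVec_norm_le (z : Fin M → ℂ) {j : Fin M} (hz : z j ≠ 0) {r : ℝ} (hr : 0 ≤ r) :
    channelLaw M N {H | ‖H *ᵥ z‖ ≤ r} ≤ ENNReal.ofReal ((2 * r ^ 2 / ‖z j‖ ^ 2) ^ N) := by
  have hset : {H : Matrix (Fin N) (Fin M) ℂ | ‖H *ᵥ z‖ ≤ r} =
      Set.univ.pi fun _ : Fin N => {h : Fin M → ℂ | ‖∑ k, h k * z k‖ ≤ r} := by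
    ext H
    simp only [Set.mem_ofPred_eq, pi_norm_le_iff_of_nonneg hr, Matrix.mulVec, dotProduct]
    exact ⟨fun h i _ => h i, fun h i => h i trivial⟩
  rw [hset]
  change (Measure.pi fun _ : Fin N => Measure.pi fun _ : Fin M => complexGaussian 1) _ ≤ _
  rw [Measure.pi_pi]
  refine (Finset.prod_le_prod' fun i _ =>
    pi_complexGaussian_linear_le one_ne_zero z hz hr).trans ?_
  rw [Finset.prod_const, ENNReal.ofReal_pow (by positivity)]
  simp

/-- Splitting off the `j`-th column of the channel matrix. -/
lemma measurePreserving_splitColumn {m : ℕ} (j : Fin (m + 1)) :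
    MeasurePreserving
      (fun p : (Fin N → ℂ) × (Fin N → Fin m → ℂ) =>
        (fun i => j.insertNth (p.1 i) (p.2 i) : Matrix (Fin N) (Fin (m + 1)) ℂ))
      ((Measure.pi fun _ : Fin N => complexGaussian 1).prod
        (Measure.pi fun _ : Fin N => Measure.pi fun _ : Fin m => complexGaussian 1))
      (channelLaw (m + 1) N) := by
  have h1 := (measurePreserving_arrowProdEquivProdArrow ℂ (Fin m → ℂ) (Fin N)
    (fun _ => complexGaussian 1) (fun _ => Measure.pi fun _ : Fin m => complexGaussian 1)).symm
  have h2 := measurePreserving_pi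
    (fun _ : Fin N => (complexGaussian 1).prod (Measure.pi fun _ : Fin m => complexGaussian 1))
    (fun _ : Fin N => Measure.pi fun _ : Fin (m + 1) => complexGaussian 1)
    (fun _ => (measurePreserving_piFinSuccAbove
      (fun _ : Fin (m + 1) => complexGaussian 1) j).symm)
  exact h2.comp h1

lemma measurableSet_exists_mulVec_norm_lt (j : Fin M) (ε : ℝ) :
    MeasurableSet {H : Matrix (Fin N) (Fin M) ℂ | ∃ c : Fin M → ℂ, c j = 1 ∧ ‖H *ᵥ c‖ < ε} := by
  suffices h : IsOpen {H : Fin N → Fin M → ℂ |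
      ∃ c : Fin M → ℂ, c j = 1 ∧ ‖Matrix.mulVec H c‖ < ε} from h.measurableSet
  have : {H : Fin N → Fin M → ℂ | ∃ c : Fin M → ℂ, c j = 1 ∧ ‖Matrix.mulVec H c‖ < ε} =
      ⋃ c : {c : Fin M → ℂ // c j = 1}, {H | ‖fun i => ∑ k, H i k * c.1 k‖ < ε} := by
    ext H
    simp only [Set.mem_ofPred_eq, Set.mem_iUnion, Subtype.exists, exists_prop]
    rfl
  rw [this]
  exact isOpen_iUnion fun c => isOpen_lt (by fun_prop) continuous_const

/-- The `j`-th column of the channel matrix is unlikely to be close to the span of the others: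
fewer than `N` other columns leave room for a nonzero vector `u` orthogonal to all of them, and the
component of the `j`-th column along `u` is Gaussian and independent of `u`. -/
lemma channelLaw_exists_mulVec_norm_lt (hMN : M ≤ N) (j : Fin M) {ε : ℝ} (hε : 0 ≤ ε) :
    channelLaw M N {H | ∃ c : Fin M → ℂ, c j = 1 ∧ ‖H *ᵥ c‖ < ε} ≤
      ENNReal.ofReal (2 * N ^ 2 * ε ^ 2) := by
  have hmeas := measurableSet_exists_mulVec_norm_lt (N := N) j ε
  obtain _ | m := M
  · exact j.elim0
  have hmp := measurePreserving_splitColumn (N := N) j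
  refine (hmp.measure_preimage hmeas.nullMeasurableSet).symm.trans_le ?_
  rw [Measure.prod_apply_symm (hmp.measurable hmeas)]
  refine (lintegral_mono (g := fun _ => ENNReal.ofReal (2 * N ^ 2 * ε ^ 2))
    fun y => ?_).trans (by simp)
  obtain ⟨u, hu0, hu⟩ : ∃ u : Fin N → ℂ, u ≠ 0 ∧ ∀ k, ∑ i, y i k * u i = 0 := by
    let f : (Fin N → ℂ) →ₗ[ℂ] (Fin m → ℂ) := Matrix.mulVecLin (Matrix.of fun k i => y i k)
    have hf : LinearMap.ker f ≠ ⊥ := LinearMap.ker_ne_bot_of_finrank_lt (by simpa using hMN)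
    obtain ⟨u, hu, hu0⟩ := Submodule.exists_mem_ne_zero_of_ne_bot hf
    exact ⟨u, hu0, fun k => congrFun (LinearMap.mem_ker.1 hu) k⟩
  have : Nonempty (Fin N) := ⟨⟨0, by omega⟩⟩
  obtain ⟨i₀, hi₀⟩ := Finite.exists_max fun i => ‖u i‖
  have hui₀ : u i₀ ≠ 0 := by
    intro h
    refine hu0 (funext fun i => norm_le_zero_iff.1 ?_)
    simpa [h] using hi₀ i
  refine le_trans (measure_mono ?_) ((pi_complexGaussian_linear_le one_ne_zero u hui₀
    (r := N * (ε * ‖u i₀‖)) (by positivity)).trans_eq ?_)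
  · rintro h ⟨c, hcj, hc⟩
    have hc' := fun i => (norm_le_pi_norm _ i).trans_lt hc
    simp only [Matrix.mulVec, dotProduct, Fin.sum_univ_succAbove _ j, Fin.insertNth_apply_same,
      Fin.insertNth_apply_succAbove, hcj, mul_one] at hc'
    have hsum : ∑ i, h i * u i = ∑ i, (h i + ∑ k, y i k * c (j.succAbove k)) * u i := by
      simp only [add_mul, Finset.sum_add_distrib, Finset.sum_mul]
      rw [Finset.sum_comm, left_eq_add]
      refine Finset.sum_eq_zero fun k _ => ?_
      have := congrArg (· * c (j.succAbove k)) (hu k)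
      simp only [Finset.sum_mul, zero_mul] at this
      rw [← this]
      exact Finset.sum_congr rfl fun i _ => by ring
    simp only [Set.mem_ofPred_eq]
    rw [hsum]
    calc _ ≤ ∑ i, ‖(h i + ∑ k, y i k * c (j.succAbove k)) * u i‖ := norm_sum_le _ _
      _ ≤ ∑ i : Fin N, ε * ‖u i₀‖ := by
          refine Finset.sum_le_sum fun i _ => ?_
          rw [norm_mul]
          gcongr
          · exact (hc' i).le
          · exact hi₀ i
      _ = _ := by simp
  · congr 1
    have : ‖u i₀‖ ≠ 0 := norm_ne_zero_iff.2 hui₀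
    simp only [NNReal.coe_one, one_mul]
    field_simp

lemma channelLaw_exists_mulVec_norm_le (hMN : M ≤ N) (j : Fin M) {ε : ℝ} (hε : 0 ≤ ε) :
    channelLaw M N {H | ∃ c : Fin M → ℂ, c j = 1 ∧ ‖H *ᵥ c‖ ≤ ε} ≤
      ENNReal.ofReal (2 * N ^ 2 * ε ^ 2) := by
  have hlim : Filter.Tendsto (fun δ : ℝ => ENNReal.ofReal (2 * N ^ 2 * δ ^ 2))
      (nhdsWithin ε (Set.Ioi ε)) (nhds (ENNReal.ofReal (2 * N ^ 2 * ε ^ 2))) := by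
    refine Filter.Tendsto.mono_left (Continuous.tendsto ?_ _) nhdsWithin_le_nhds
    exact ENNReal.continuous_ofReal.comp (by fun_prop)
  refine ge_of_tendsto hlim ?_
  filter_upwards [self_mem_nhdsWithin] with δ (hδ : ε < δ)
  refine le_trans (measure_mono ?_) (channelLaw_exists_mulVec_norm_lt hMN j (hε.trans hδ.le))
  rintro H ⟨c, hc, hH⟩
  exact ⟨c, hc, hH.trans_lt hδ⟩

lemma column_linearIndependent_iff (H : Matrix (Fin N) (Fin M) ℂ) :
    LinearIndependent ℂ (column H) ↔ ∀ c : Fin M → ℂ, H *ᵥ c = 0 → c = 0 := by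
  rw [Fintype.linearIndependent_iff]
  have : ∀ c : Fin M → ℂ, ∑ k, c k • column H k = WithLp.toLp 2 (H *ᵥ c) := by
    intro c
    ext i
    simp [column, Matrix.mulVec, dotProduct, mul_comm]
  simp only [this, WithLp.toLp_eq_zero]
  exact forall_congr' fun c => imp_congr_right fun _ =>
    ⟨fun h => funext h, fun h k => congrFun h k⟩

lemma channelLaw_not_linearIndependent (hMN : M ≤ N) :
    channelLaw M N {H | ¬ LinearIndependent ℂ (column H)} = 0 := by
  refine measure_mono_null (t := ⋃ j : Fin M, {H | ∃ c : Fin M → ℂ, c j = 1 ∧ ‖H *ᵥ c‖ ≤ 0}) ?_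
    (measure_iUnion_null fun j => ?_)
  · intro H hH
    simp only [Set.mem_ofPred_eq, column_linearIndependent_iff] at hH
    push Not at hH
    obtain ⟨c, hc, hc0⟩ := hH
    obtain ⟨j, hj⟩ := Function.ne_iff.1 hc0
    refine Set.mem_iUnion.2 ⟨j, (c j)⁻¹ • c, by simpa using inv_mul_cancel₀ hj, ?_⟩
    rw [Matrix.mulVec_smul, hc]
    simp
  · simpa using channelLaw_exists_mulVec_norm_le hMN j le_rfl

/-- The Gaussian integers whose real and imaginary parts are at most `K` in absolute value. -/
def gaussianBox (K : ℕ) : Finset GaussianInt :=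
  (Finset.Icc (-K : ℤ) K ×ˢ Finset.Icc (-K : ℤ) K).image fun p => ⟨p.1, p.2⟩

lemma card_gaussianBox_le (K : ℕ) : (gaussianBox K).card ≤ (2 * K + 1) ^ 2 := by
  refine Finset.card_image_le.trans ?_
  rw [Finset.card_product, Int.card_Icc, sq]
  have : ((K : ℤ) + 1 - -K).toNat = 2 * K + 1 := by omega
  rw [this]

lemma mem_gaussianBox {K : ℕ} {z : GaussianInt} :
    z ∈ gaussianBox K ↔ |z.re| ≤ K ∧ |z.im| ≤ K := by
  simp only [gaussianBox, Finset.mem_image, Finset.mem_product, Finset.mem_Icc, abs_le]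
  exact ⟨fun ⟨p, hp, h⟩ => h ▸ hp, fun h => ⟨(z.re, z.im), h, rfl⟩⟩

/-- The vectors of Gaussian integers whose largest coordinate has modulus about `2 ^ m`. -/
def dyadicShell (M m : ℕ) : Set (Fin M → GaussianInt) :=
  {z | (∀ k, z k ∈ gaussianBox (2 ^ (m + 1))) ∧ ∃ j, 2 ^ m ≤ ‖GaussianInt.toComplex (z j)‖}

lemma exists_mem_dyadicShell {z : Fin M → GaussianInt} (hz : z ≠ 0) :
    ∃ m, z ∈ dyadicShell M m := by
  obtain ⟨j₁, hj₁⟩ := Function.ne_iff.1 hz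
  have : Nonempty (Fin M) := ⟨j₁⟩
  obtain ⟨j, hj⟩ := Finite.exists_max fun k => max (z k).re.natAbs (z k).im.natAbs
  set K := max (z j).re.natAbs (z j).im.natAbs with hK
  have hK0 : K ≠ 0 := by
    intro h0
    have h1 := hj j₁
    rw [h0, Nat.le_zero, Nat.max_eq_zero_iff] at h1
    exact hj₁ (Zsqrtd.ext (by simpa using h1.1) (by simpa using h1.2))
  refine ⟨Nat.log 2 K, fun k => mem_gaussianBox.2 ?_, j, ?_⟩
  · have h1 := (hj k).trans (Nat.lt_pow_succ_log_self one_lt_two K).le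
    have h2 := (le_max_left _ _).trans h1
    have h3 := (le_max_right _ _).trans h1
    push_cast at h2 h3 ⊢
    rw [Int.abs_eq_natAbs, Int.abs_eq_natAbs]
    exact ⟨by exact_mod_cast h2, by exact_mod_cast h3⟩
  · have h1 : (2 : ℝ) ^ Nat.log 2 K ≤ K := by exact_mod_cast Nat.pow_log_le_self 2 hK0
    refine h1.trans ?_
    rw [hK, Nat.cast_max, Nat.cast_natAbs, Nat.cast_natAbs, Int.cast_abs, Int.cast_abs,
      GaussianInt.intCast_re, GaussianInt.intCast_im]
    exact max_le (Complex.abs_re_le_norm _) (Complex.abs_im_le_norm _)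

lemma channelLaw_dyadicShell_le (m : ℕ) {r : ℝ} (hr : 0 ≤ r) :
    channelLaw M N {H | ∃ z ∈ dyadicShell M m, ‖H *ᵥ toComplexVec z‖ ≤ r} ≤
      ENNReal.ofReal (64 ^ M * 2 ^ N * r ^ (2 * N) * (4 ^ M / 4 ^ N) ^ m) := by
  classical
  set S : Finset (Fin M → GaussianInt) :=
    (Fintype.piFinset fun _ : Fin M => gaussianBox (2 ^ (m + 1))).filter
      fun z => z ∈ dyadicShell M m with hS
  have hcard : (S.card : ℝ) ≤ 64 ^ M * (4 ^ M) ^ m := by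
    have h1 : S.card ≤ ((2 * 2 ^ (m + 1) + 1) ^ 2) ^ M := by
      refine (Finset.card_filter_le _ _).trans ?_
      rw [Fintype.card_piFinset, Finset.prod_const, Finset.card_univ, Fintype.card_fin]
      exact Nat.pow_le_pow_left (card_gaussianBox_le _) _
    have h2 : (2 * 2 ^ (m + 1) + 1) ^ 2 ≤ 64 * 4 ^ m := by
      have : 1 ≤ 2 ^ m := Nat.one_le_two_pow
      have h4 : 4 ^ m = 2 ^ m * 2 ^ m := by rw [← mul_pow]; norm_num
      rw [h4, pow_succ 2 m]
      nlinarith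
    calc (S.card : ℝ) ≤ (((2 * 2 ^ (m + 1) + 1) ^ 2 : ℕ) : ℝ) ^ M := by exact_mod_cast h1
      _ ≤ ((64 * 4 ^ m : ℕ) : ℝ) ^ M := by gcongr
      _ = _ := by push_cast; rw [mul_pow, ← pow_mul, ← pow_mul, mul_comm m M]
  have hsub : {H : Matrix (Fin N) (Fin M) ℂ | ∃ z ∈ dyadicShell M m, ‖H *ᵥ toComplexVec z‖ ≤ r} ⊆
      ⋃ z ∈ S, {H | ‖H *ᵥ toComplexVec z‖ ≤ r} := by
    rintro H ⟨z, hz, hH⟩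
    exact Set.mem_biUnion (Finset.mem_coe.2 (Finset.mem_filter.2
      ⟨Fintype.mem_piFinset.2 hz.1, hz⟩)) hH
  calc _ ≤ ∑ z ∈ S, channelLaw M N {H | ‖H *ᵥ toComplexVec z‖ ≤ r} :=
        (measure_mono hsub).trans (measure_biUnion_finset_le _ _)
    _ ≤ ∑ z ∈ S, ENNReal.ofReal ((2 * r ^ 2 / 4 ^ m) ^ N) := by
        refine Finset.sum_le_sum fun z hz => ?_
        obtain ⟨j, hj⟩ := (Finset.mem_filter.1 hz).2.2
        have hpos : 0 < ‖GaussianInt.toComplex (z j)‖ := lt_of_lt_of_le (by positivity) hj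
        refine (channelLaw_mulVec_norm_le (toComplexVec z) (j := j) (norm_pos_iff.1 hpos) hr).trans
          (ENNReal.ofReal_le_ofReal ?_)
        have h4 : (4 : ℝ) ^ m ≤ ‖toComplexVec z j‖ ^ 2 := by
          calc (4 : ℝ) ^ m = (2 ^ m) ^ 2 := by rw [← pow_mul, mul_comm, pow_mul]; norm_num
            _ ≤ _ := by gcongr; exact hj
        gcongr
    _ = ENNReal.ofReal (S.card * (2 * r ^ 2 / 4 ^ m) ^ N) := by
        rw [Finset.sum_const, nsmul_eq_mul, ENNReal.ofReal_mul (by positivity),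
          ENNReal.ofReal_natCast]
    _ ≤ _ := by
        refine ENNReal.ofReal_le_ofReal ?_
        calc _ ≤ 64 ^ M * (4 ^ M) ^ m * (2 * r ^ 2 / 4 ^ m) ^ N := by gcongr
          _ = _ := by
            rw [div_pow, div_pow, mul_pow, ← pow_mul, ← pow_mul, ← pow_mul, ← pow_mul,
              mul_comm m N]
            ring

/-- For `M < N`, the union bound over all shells is a convergent geometric series. -/
lemma channelLaw_exists_short_le_of_lt (hMN : M < N) {r : ℝ} (hr : 0 ≤ r) :
    channelLaw M N {H | ∃ z : Fin M → GaussianInt, z ≠ 0 ∧ ‖H *ᵥ toComplexVec z‖ ≤ r} ≤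
      ENNReal.ofReal (2 * 64 ^ M * 2 ^ N * r ^ (2 * N)) := by
  have hq : (4 : ℝ) ^ M / 4 ^ N ≤ 1 / 2 := by
    rw [div_le_div_iff₀ (by positivity) two_pos]
    calc (4 : ℝ) ^ M * 2 ≤ 4 ^ M * 4 := by gcongr; norm_num
      _ = 4 ^ (M + 1) := by ring
      _ ≤ 4 ^ N := pow_le_pow_right₀ (by norm_num) hMN
      _ = _ := by ring
  have hsub : {H : Matrix (Fin N) (Fin M) ℂ |
      ∃ z : Fin M → GaussianInt, z ≠ 0 ∧ ‖H *ᵥ toComplexVec z‖ ≤ r} ⊆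
      ⋃ m, {H | ∃ z ∈ dyadicShell M m, ‖H *ᵥ toComplexVec z‖ ≤ r} := by
    rintro H ⟨z, hz, hH⟩
    obtain ⟨m, hm⟩ := exists_mem_dyadicShell hz
    exact Set.mem_iUnion.2 ⟨m, z, hm, hH⟩
  calc _ ≤ ∑' m, channelLaw M N {H | ∃ z ∈ dyadicShell M m, ‖H *ᵥ toComplexVec z‖ ≤ r} :=
        (measure_mono hsub).trans (measure_iUnion_le _)
    _ ≤ ∑' m : ℕ, ENNReal.ofReal (64 ^ M * 2 ^ N * r ^ (2 * N) * (1 / 2) ^ m) := by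
        refine ENNReal.tsum_le_tsum fun m => (channelLaw_dyadicShell_le m hr).trans
          (ENNReal.ofReal_le_ofReal ?_)
        gcongr
    _ = _ := by
        rw [← ENNReal.ofReal_tsum_of_nonneg (fun m => by positivity)
          (summable_geometric_two.mul_left _), tsum_mul_left, tsum_geometric_two]
        congr 1; ring

/-- For `M = N` every shell contributes equally; the far shells are controlled by the distance of
a column from the span of the others. -/
lemma channelLaw_exists_short_le (L : ℕ) {r : ℝ} (hr : 0 ≤ r) :
    channelLaw N N {H | ∃ z : Fin N → GaussianInt, z ≠ 0 ∧ ‖H *ᵥ toComplexVec z‖ ≤ r} ≤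
      ENNReal.ofReal (L * (64 ^ N * 2 ^ N * r ^ (2 * N)) + 2 * N ^ 3 * r ^ 2 / 4 ^ L) := by
  have hsub : {H : Matrix (Fin N) (Fin N) ℂ |
      ∃ z : Fin N → GaussianInt, z ≠ 0 ∧ ‖H *ᵥ toComplexVec z‖ ≤ r} ⊆
      (⋃ m ∈ Finset.range L, {H | ∃ z ∈ dyadicShell N m, ‖H *ᵥ toComplexVec z‖ ≤ r}) ∪
      ⋃ j ∈ (Finset.univ : Finset (Fin N)),
        {H | ∃ c : Fin N → ℂ, c j = 1 ∧ ‖H *ᵥ c‖ ≤ r / 2 ^ L} := by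
    rintro H ⟨z, hz, hH⟩
    obtain ⟨m, hm⟩ := exists_mem_dyadicShell hz
    rcases lt_or_ge m L with hmL | hmL
    · exact Or.inl (Set.mem_biUnion (Finset.mem_coe.2 (Finset.mem_range.2 hmL)) ⟨z, hm, hH⟩)
    · obtain ⟨j, hj⟩ := hm.2
      have hL : (2 : ℝ) ^ L ≤ ‖toComplexVec z j‖ :=
        (pow_le_pow_right₀ one_le_two hmL).trans hj
      have hpos : 0 < ‖toComplexVec z j‖ := lt_of_lt_of_le (by positivity) hL
      refine Or.inr (Set.mem_biUnion (Finset.mem_coe.2 (Finset.mem_univ j))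
        ⟨(toComplexVec z j)⁻¹ • toComplexVec z, ?_, ?_⟩)
      · simpa using inv_mul_cancel₀ (norm_pos_iff.1 hpos)
      · rw [Matrix.mulVec_smul, norm_smul, norm_inv, inv_mul_eq_div]
        gcongr
  refine (measure_mono hsub).trans ((measure_union_le _ _).trans ?_)
  rw [ENNReal.ofReal_add (by positivity) (by positivity)]
  gcongr
  · refine (measure_biUnion_finset_le _ _).trans ?_
    calc _ ≤ ∑ m ∈ Finset.range L, ENNReal.ofReal (64 ^ N * 2 ^ N * r ^ (2 * N)) := by
          refine Finset.sum_le_sum fun m _ => (channelLaw_dyadicShell_le m hr).trans_eq ?_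
          rw [div_self (by positivity), one_pow, mul_one]
      _ = _ := by
          rw [Finset.sum_const, nsmul_eq_mul, ENNReal.ofReal_mul (p := L) (by positivity),
            ENNReal.ofReal_natCast, Finset.card_range]
  · refine (measure_biUnion_finset_le _ _).trans ?_
    calc _ ≤ ∑ j : Fin N, ENNReal.ofReal (2 * N ^ 2 * (r / 2 ^ L) ^ 2) :=
          Finset.sum_le_sum fun j _ => channelLaw_exists_mulVec_norm_le le_rfl j (by positivity)
      _ = ENNReal.ofReal (N * (2 * N ^ 2 * (r / 2 ^ L) ^ 2)) := by
          rw [Finset.sum_const, nsmul_eq_mul, ENNReal.ofReal_mul (p := N) (by positivity),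
            ENNReal.ofReal_natCast, Finset.card_univ, Fintype.card_fin]
      _ = _ := by
          congr 1
          rw [div_pow, ← pow_mul, mul_comm L 2, pow_mul]
          norm_num
          ring

end ShortVectors

/-! ### Moments of the noise -/

section Moments

open MeasureTheory ProbabilityTheory

lemma lintegral_pow_gaussianReal (v : ℝ≥0) (k : ℕ) :
    ∫⁻ x, ENNReal.ofReal (x ^ (2 * k)) ∂gaussianReal 0 v =
      (v : ℝ≥0∞) ^ k * ∫⁻ x, ENNReal.ofReal (x ^ (2 * k)) ∂gaussianReal 0 1 := by
  have hmap : (gaussianReal 0 1).map (Real.sqrt v * ·) = gaussianReal 0 v := by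
    rw [gaussianReal_map_const_mul]
    congr 1
    · simp
    · ext; simp
  rw [← hmap, lintegral_map (by fun_prop) (by fun_prop), ← lintegral_const_mul _ (by fun_prop)]
  refine lintegral_congr fun x => ?_
  rw [mul_pow, pow_mul (Real.sqrt v), Real.sq_sqrt v.coe_nonneg, ENNReal.ofReal_mul (by positivity),
    ENNReal.ofReal_pow v.coe_nonneg, ENNReal.ofReal_coe_nnreal]

lemma lintegral_pow_gaussianReal_ne_top (k : ℕ) :
    ∫⁻ x, ENNReal.ofReal (x ^ (2 * k)) ∂gaussianReal 0 1 ≠ ∞ := by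
  have h := (memLp_id_gaussianReal (μ := 0) (v := 1) ((2 * k : ℕ) : ℝ≥0)).integrable_norm_pow'
  have h2 := h.lintegral_lt_top.ne
  simpa [pow_mul] using h2

lemma norm_pow_le_re_add_im (z : ℂ) (k : ℕ) :
    ‖z‖ ^ (2 * k) ≤ 2 ^ k * (z.re ^ (2 * k) + z.im ^ (2 * k)) := by
  have h0 : ‖z‖ ^ 2 = z.re ^ 2 + z.im ^ 2 := by
    rw [Complex.sq_norm, Complex.normSq_apply]; ring
  rw [pow_mul, pow_mul, pow_mul, h0]
  have hre := sq_nonneg z.re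
  have him := sq_nonneg z.im
  rcases le_total (z.re ^ 2) (z.im ^ 2) with h | h
  · calc _ ≤ (2 * z.im ^ 2) ^ k := by gcongr; linarith
      _ = 2 ^ k * (z.im ^ 2) ^ k := mul_pow _ _ _
      _ ≤ _ := by gcongr; exact le_add_of_nonneg_left (by positivity)
  · calc _ ≤ (2 * z.re ^ 2) ^ k := by gcongr; linarith
      _ = 2 ^ k * (z.re ^ 2) ^ k := mul_pow _ _ _
      _ ≤ _ := by gcongr; exact le_add_of_nonneg_right (by positivity)

/-- The even moments of the noise scale like powers of its variance `1 / ρ`. -/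
lemma exists_lintegral_norm_pow_noiseLaw_le {N : ℕ} (hN : 1 ≤ N) (k : ℕ) :
    ∃ C : ℝ, 0 ≤ C ∧ ∀ ρ : ℝ, 0 < ρ →
      ∫⁻ w, ENNReal.ofReal (‖w‖ ^ (2 * k)) ∂noiseLaw N ρ ≤ ENNReal.ofReal (C / ρ ^ k) := by
  set m : ℝ≥0∞ := ∫⁻ x, ENNReal.ofReal (x ^ (2 * k)) ∂gaussianReal 0 1 with hm
  have hmtop : m ≠ ∞ := lintegral_pow_gaussianReal_ne_top k
  refine ⟨N * (2 ^ k * (2 * m.toReal)), by positivity, fun ρ hρ => ?_⟩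
  set v : ℝ≥0 := (1 / ρ).toNNReal with hv
  have hvk : ((v / 2 : ℝ≥0) : ℝ≥0∞) ^ k * m ≤ ENNReal.ofReal (m.toReal / ρ ^ k) := by
    calc _ ≤ (v : ℝ≥0∞) ^ k * m := by
          gcongr
          exact half_le_self (zero_le)
      _ = _ := by
          rw [hv, ← ENNReal.ofReal, ← ENNReal.ofReal_pow (by positivity),
            ← ENNReal.ofReal_toReal hmtop, ← ENNReal.ofReal_mul (by positivity),
            ENNReal.ofReal_toReal hmtop]
          rw [one_div, inv_pow, inv_mul_eq_div]
  have hone : ∫⁻ z, ENNReal.ofReal (‖z‖ ^ (2 * k)) ∂complexGaussian v ≤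
      ENNReal.ofReal (2 ^ k * (2 * m.toReal) / ρ ^ k) := by
    calc _ ≤ ∫⁻ z, ENNReal.ofReal (2 ^ k) * (ENNReal.ofReal (z.re ^ (2 * k)) +
            ENNReal.ofReal (z.im ^ (2 * k))) ∂complexGaussian v := by
          refine lintegral_mono fun z => ?_
          have h1 : 0 ≤ z.re ^ (2 * k) := (even_two_mul k).pow_nonneg _
          have h2 : 0 ≤ z.im ^ (2 * k) := (even_two_mul k).pow_nonneg _
          rw [← ENNReal.ofReal_add h1 h2, ← ENNReal.ofReal_mul (by positivity)]
          exact ENNReal.ofReal_le_ofReal (norm_pow_le_re_add_im z k)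
      _ = ENNReal.ofReal (2 ^ k) * (((v / 2 : ℝ≥0) : ℝ≥0∞) ^ k * m +
            ((v / 2 : ℝ≥0) : ℝ≥0∞) ^ k * m) := by
          unfold complexGaussian
          rw [lintegral_map (by fun_prop) (by fun_prop), lintegral_const_mul _ (by fun_prop),
            lintegral_add_left (by fun_prop)]
          congr 2
          · rw [← lintegral_pow_gaussianReal]
            exact (measurePreserving_fst (μ := gaussianReal 0 (v / 2))
              (ν := gaussianReal 0 (v / 2))).lintegral_comp
              (f := fun x => ENNReal.ofReal (x ^ (2 * k))) (by fun_prop)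
          · rw [← lintegral_pow_gaussianReal]
            exact (measurePreserving_snd (μ := gaussianReal 0 (v / 2))
              (ν := gaussianReal 0 (v / 2))).lintegral_comp
              (f := fun x => ENNReal.ofReal (x ^ (2 * k))) (by fun_prop)
      _ ≤ ENNReal.ofReal (2 ^ k) * (ENNReal.ofReal (m.toReal / ρ ^ k) +
            ENNReal.ofReal (m.toReal / ρ ^ k)) := by gcongr
      _ = _ := by
          rw [← ENNReal.ofReal_add (by positivity) (by positivity),
            ← ENNReal.ofReal_mul (by positivity)]
          congr 1; ring
  have hne : Nonempty (Fin N) := ⟨⟨0, hN⟩⟩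
  calc _ ≤ ∫⁻ w, ∑ i : Fin N, ENNReal.ofReal (‖w i‖ ^ (2 * k)) ∂noiseLaw N ρ := by
        refine lintegral_mono fun w => ?_
        obtain ⟨i, hi⟩ := Finite.exists_max fun i => ‖w i‖
        have hw : ‖w‖ ≤ ‖w i‖ := (pi_norm_le_iff_of_nonneg (norm_nonneg _)).2 hi
        calc _ ≤ ENNReal.ofReal (‖w i‖ ^ (2 * k)) := by gcongr
          _ ≤ _ := Finset.single_le_sum (f := fun i => ENNReal.ofReal (‖w i‖ ^ (2 * k)))
            (fun _ _ => zero_le) (Finset.mem_univ i)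
    _ = ∑ i : Fin N, ∫⁻ z, ENNReal.ofReal (‖z‖ ^ (2 * k)) ∂complexGaussian v := by
        rw [lintegral_finsetSum _ fun i _ => by fun_prop]
        refine Finset.sum_congr rfl fun i _ => ?_
        exact (measurePreserving_eval (fun _ : Fin N => complexGaussian v) i).lintegral_comp
          (f := fun z => ENNReal.ofReal (‖z‖ ^ (2 * k))) (by fun_prop)
    _ ≤ ∑ i : Fin N, ENNReal.ofReal (2 ^ k * (2 * m.toReal) / ρ ^ k) :=
        Finset.sum_le_sum fun _ _ => hone
    _ = _ := by
        rw [Finset.sum_const, nsmul_eq_mul, ← ENNReal.ofReal_natCast,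
          ← ENNReal.ofReal_mul (by positivity)]
        congr 1
        simp
        ring

end Moments

/-! ### Decoding after a change of basis -/

section Decoding

open MeasureTheory ProbabilityTheory

variable {M N : ℕ}

lemma toComplexMatrix_mul (U V : Matrix (Fin M) (Fin M) GaussianInt) :
    toComplexMatrix (U * V) = toComplexMatrix U * toComplexMatrix V :=
  Matrix.map_mul

lemma toComplexMatrix_one : toComplexMatrix (1 : Matrix (Fin M) (Fin M) GaussianInt) = 1 :=
  Matrix.map_one _ (map_zero _) (map_one _)

lemma toComplexMatrix_conjTranspose (U : Matrix (Fin M) (Fin M) GaussianInt) :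
    toComplexMatrix Uᴴ = (toComplexMatrix U)ᴴ := by
  ext i j
  simp only [toComplexMatrix, Matrix.map_apply, Matrix.conjTranspose_apply]
  exact GaussianInt.toComplex_star _

lemma toComplexVec_mulVec (U : Matrix (Fin M) (Fin M) GaussianInt) (x : Fin M → GaussianInt) :
    toComplexVec (U *ᵥ x) = toComplexMatrix U *ᵥ toComplexVec x := by
  ext i
  simp [toComplexVec, toComplexMatrix, Matrix.mulVec, dotProduct]

lemma toComplexMatrix_mul_inv {V : Matrix (Fin M) (Fin M) GaussianInt} (hV : IsUnit V.det) :
    toComplexMatrix V * toComplexMatrix V⁻¹ = 1 := by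
  rw [← toComplexMatrix_mul, Matrix.mul_nonsing_inv _ hV, toComplexMatrix_one]

lemma toComplexMatrix_inv_mul {V : Matrix (Fin M) (Fin M) GaussianInt} (hV : IsUnit V.det) :
    toComplexMatrix V⁻¹ * toComplexMatrix V = 1 := by
  rw [← toComplexMatrix_mul, Matrix.nonsing_inv_mul _ hV, toComplexMatrix_one]

open scoped ComplexOrder in
lemma isUnit_gram_of_linearIndependent {H : Matrix (Fin N) (Fin M) ℂ}
    (hH : LinearIndependent ℂ (column H)) : IsUnit (Hᴴ * H).det := by
  rw [← Matrix.isUnit_iff_isUnit_det, ← Matrix.mulVec_injective_iff_isUnit,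
    ← Matrix.coe_mulVecLin, ← LinearMap.ker_eq_bot, Matrix.ker_mulVecLin_conjTranspose_mul_self,
    LinearMap.ker_eq_bot']
  exact (column_linearIndependent_iff H).1 hH

lemma pinv_mul_self {H : Matrix (Fin N) (Fin M) ℂ} (hH : LinearIndependent ℂ (column H)) :
    pinv H * H = 1 := by
  rw [pinv, Matrix.mul_assoc, Matrix.nonsing_inv_mul _ (isUnit_gram_of_linearIndependent hH)]

lemma pinv_mul_toComplexMatrix (H : Matrix (Fin N) (Fin M) ℂ)
    {U : Matrix (Fin M) (Fin M) GaussianInt} (hU : IsUnit U.det) :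
    pinv (H * toComplexMatrix U) = toComplexMatrix U⁻¹ * pinv H := by
  have h1 : (toComplexMatrix U)⁻¹ = toComplexMatrix U⁻¹ :=
    Matrix.inv_eq_right_inv (toComplexMatrix_mul_inv hU)
  have h2 : ((toComplexMatrix U)ᴴ)⁻¹ * (toComplexMatrix U)ᴴ = 1 := by
    rw [← Matrix.conjTranspose_nonsing_inv, ← Matrix.conjTranspose_mul, h1,
      toComplexMatrix_mul_inv hU, Matrix.conjTranspose_one]
  calc _ = ((toComplexMatrix U)ᴴ * ((Hᴴ * H) * toComplexMatrix U))⁻¹ *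
        ((toComplexMatrix U)ᴴ * Hᴴ) := by
        rw [pinv, Matrix.conjTranspose_mul]; simp only [Matrix.mul_assoc]
    _ = (toComplexMatrix U)⁻¹ * (Hᴴ * H)⁻¹ *
        (((toComplexMatrix U)ᴴ)⁻¹ * (toComplexMatrix U)ᴴ) * Hᴴ := by
        rw [Matrix.mul_inv_rev, Matrix.mul_inv_rev]; simp only [Matrix.mul_assoc]
    _ = _ := by rw [h2, h1, Matrix.mul_one, pinv, Matrix.mul_assoc]

lemma nearestPoint_toComplexVec_add (x : Fin M → GaussianInt) (e : Fin M → ℂ) :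
    nearestPoint (toComplexVec x + e) = x + nearestPoint e := by
  ext j
  · simp [nearestPoint, toComplexVec, ← GaussianInt.intCast_re]
  · simp [nearestPoint, toComplexVec, ← GaussianInt.intCast_im]

lemma exists_half_le_norm_of_nearestPoint_ne_zero {e : Fin M → ℂ} (he : nearestPoint e ≠ 0) :
    ∃ j, 1 / 2 ≤ ‖e j‖ := by
  by_contra! h
  refine he (funext fun j => Zsqrtd.ext ?_ ?_)
  · have := abs_lt.1 ((Complex.abs_re_le_norm (e j)).trans_lt (h j))
    exact round_eq_zero_iff.2 ⟨by linarith, this.2⟩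
  · have := abs_lt.1 ((Complex.abs_im_le_norm (e j)).trans_lt (h j))
    exact round_eq_zero_iff.2 ⟨by linarith, this.2⟩

lemma norm_le_one_of_nearestPoint_eq_zero {e : Fin M → ℂ} (he : nearestPoint e = 0) (j : Fin M) :
    ‖e j‖ ≤ 1 := by
  have h1 := round_eq_zero_iff.1 (congrArg Zsqrtd.re (congrFun he j))
  have h2 := round_eq_zero_iff.1 (congrArg Zsqrtd.im (congrFun he j))
  have h1' : |(e j).re| ≤ 1 / 2 := abs_le.2 ⟨by linarith [h1.1], h1.2.le⟩
  have h2' : |(e j).im| ≤ 1 / 2 := abs_le.2 ⟨by linarith [h2.1], h2.2.le⟩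
  linarith [Complex.norm_le_abs_re_add_abs_im (e j)]

/-- Whether decoding succeeds depends on the noise only, since rounding commutes with translation
by Gaussian integers. -/
lemma inv_mulVec_nearestPoint_eq_iff {H : Matrix (Fin N) (Fin M) ℂ}
    (hH : LinearIndependent ℂ (column H)) {V : Matrix (Fin M) (Fin M) GaussianInt}
    (hV : IsUnit V.det) (x : Fin M → GaussianInt) (w : Fin N → ℂ) :
    V⁻¹ *ᵥ nearestPoint ((toComplexMatrix V * pinv H) *ᵥ (H *ᵥ toComplexVec x + w)) = x ↔
      nearestPoint ((toComplexMatrix V * pinv H) *ᵥ w) = 0 := by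
  have h1 : (toComplexMatrix V * pinv H) *ᵥ (H *ᵥ toComplexVec x + w) =
      toComplexVec (V *ᵥ x) + (toComplexMatrix V * pinv H) *ᵥ w := by
    rw [Matrix.mulVec_add, Matrix.mulVec_mulVec, Matrix.mul_assoc, pinv_mul_self hH,
      Matrix.mul_one, toComplexVec_mulVec]
  rw [h1, nearestPoint_toComplexVec_add, Matrix.mulVec_add, Matrix.mulVec_mulVec,
    Matrix.nonsing_inv_mul _ hV, Matrix.one_mulVec, add_eq_left]
  constructor
  · intro h
    have := congrArg (V *ᵥ ·) h
    simpa [Matrix.mulVec_mulVec, Matrix.mul_nonsing_inv _ hV] using this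
  · intro h
    rw [h, Matrix.mulVec_zero]

lemma decodeI_eq (U : Matrix (Fin N) (Fin M) ℂ → GL (Fin M) GaussianInt)
    (H : Matrix (Fin N) (Fin M) ℂ) (y : Fin N → ℂ) :
    decodeI U H y = ((U H).valᴴ)⁻¹ *ᵥ
      nearestPoint ((toComplexMatrix (U H).valᴴ * pinv H) *ᵥ y) := by
  rw [decodeI, Matrix.conjTranspose_mul, invHerm, Matrix.conjTranspose_conjTranspose,
    toComplexMatrix_conjTranspose]

lemma isUnit_det_val (U : GL (Fin M) GaussianInt) : IsUnit U.val.det :=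
  (Matrix.isUnit_iff_isUnit_det _).1 U.isUnit

lemma decodeII_eq (U : Matrix (Fin N) (Fin M) ℂ → GL (Fin M) GaussianInt)
    (H : Matrix (Fin N) (Fin M) ℂ) (y : Fin N → ℂ) :
    decodeII U H y = ((U H).val⁻¹)⁻¹ *ᵥ
      nearestPoint ((toComplexMatrix (U H).val⁻¹ * pinv H) *ᵥ y) := by
  rw [decodeII, pinv_mul_toComplexMatrix _ (isUnit_det_val _),
    Matrix.nonsing_inv_nonsing_inv _ (isUnit_det_val _)]

lemma inner_column (X Y : Matrix (Fin N) (Fin M) ℂ) (i j : Fin M) :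
    inner ℂ (column X i) (column Y j) = (Xᴴ * Y) i j := by
  simp [column, PiLp.inner_apply, Matrix.mul_apply, mul_comm]

lemma column_mul_mem_span (Y : Matrix (Fin N) (Fin M) ℂ) (T : Matrix (Fin M) (Fin M) ℂ)
    (j : Fin M) : column (Y * T) j ∈ Submodule.span ℂ (Set.range (column Y)) := by
  have : column (Y * T) j = ∑ k, T k j • column Y k := by
    ext i
    simp [column, Matrix.mul_apply, mul_comm]
  rw [this]
  exact Submodule.sum_mem _ fun k _ => Submodule.smul_mem _ _ (Submodule.subset_span ⟨k, rfl⟩)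

lemma norm_column_mul_norm_column_le {η : ℝ} (hη : 1 / 2 < η) (hη' : η < 1)
    {B A : Matrix (Fin N) (Fin M) ℂ} {T : Matrix (Fin M) (Fin M) ℂ} (hB : IsLLLReduced η B)
    (hBA : Bᴴ * A = 1) (hA : A = B * T) (i : Fin M) :
    ‖column B i‖ * ‖column A i‖ ≤ dualConst M η := by
  refine norm_column_mul_norm_dual_le hB hη hη' (hA ▸ column_mul_mem_span B T i) fun j => ?_
  rw [inner_column, hBA, Matrix.one_apply]

lemma conjTranspose_gram_inv (H : Matrix (Fin N) (Fin M) ℂ) : ((Hᴴ * H)⁻¹)ᴴ = (Hᴴ * H)⁻¹ := by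
  rw [Matrix.conjTranspose_nonsing_inv, Matrix.conjTranspose_mul,
    Matrix.conjTranspose_conjTranspose]

/-- The rows of the equalizer `V H⁻¹` and the columns of `H V⁻¹` are dual bases; if the former are
LLL-reduced, the products of the norms of corresponding vectors are bounded. -/
lemma dual_bound_of_reduced_rows {η : ℝ} (hη : 1 / 2 < η) (hη' : η < 1)
    {H : Matrix (Fin N) (Fin M) ℂ} (hH : LinearIndependent ℂ (column H))
    {V : Matrix (Fin M) (Fin M) GaussianInt} (hV : IsUnit V.det)
    (hred : IsLLLReduced η (toComplexMatrix V * pinv H)ᴴ) (i : Fin M) :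
    ‖column (toComplexMatrix V * pinv H)ᴴ i‖ * ‖column (H * toComplexMatrix V⁻¹) i‖ ≤
      dualConst M η := by
  refine norm_column_mul_norm_column_le hη hη' hred
    (T := (toComplexMatrix V⁻¹)ᴴ * (Hᴴ * H) * toComplexMatrix V⁻¹) ?_ ?_ i
  · rw [Matrix.conjTranspose_conjTranspose, Matrix.mul_assoc, ← Matrix.mul_assoc (pinv H),
      pinv_mul_self hH, Matrix.one_mul, toComplexMatrix_mul_inv hV]
  · have h1 : (toComplexMatrix V)ᴴ * (toComplexMatrix V⁻¹)ᴴ = 1 := by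
      rw [← Matrix.conjTranspose_mul, toComplexMatrix_inv_mul hV, Matrix.conjTranspose_one]
    rw [pinv, Matrix.conjTranspose_mul, Matrix.conjTranspose_mul,
      Matrix.conjTranspose_conjTranspose, conjTranspose_gram_inv]
    calc _ = H * ((Hᴴ * H)⁻¹ * (Hᴴ * H)) * toComplexMatrix V⁻¹ := by
          rw [Matrix.nonsing_inv_mul _ (isUnit_gram_of_linearIndependent hH), Matrix.mul_one]
      _ = H * (Hᴴ * H)⁻¹ * ((toComplexMatrix V)ᴴ * (toComplexMatrix V⁻¹)ᴴ) * (Hᴴ * H) *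
          toComplexMatrix V⁻¹ := by rw [h1]; simp only [Matrix.mul_assoc, Matrix.one_mul]
      _ = _ := by simp only [Matrix.mul_assoc]

lemma dual_bound_of_reduced_columns {η : ℝ} (hη : 1 / 2 < η) (hη' : η < 1)
    {H : Matrix (Fin N) (Fin M) ℂ} (hH : LinearIndependent ℂ (column H))
    {V : Matrix (Fin M) (Fin M) GaussianInt} (hV : IsUnit V.det)
    (hred : IsLLLReduced η (H * toComplexMatrix V⁻¹)) (i : Fin M) :
    ‖column (toComplexMatrix V * pinv H)ᴴ i‖ * ‖column (H * toComplexMatrix V⁻¹) i‖ ≤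
      dualConst M η := by
  rw [mul_comm]
  refine norm_column_mul_norm_column_le hη hη' hred
    (T := toComplexMatrix V * (Hᴴ * H)⁻¹ * (toComplexMatrix V)ᴴ) ?_ ?_ i
  · rw [← Matrix.conjTranspose_mul, Matrix.mul_assoc, ← Matrix.mul_assoc (pinv H),
      pinv_mul_self hH, Matrix.one_mul, toComplexMatrix_mul_inv hV, Matrix.conjTranspose_one]
  · rw [pinv, Matrix.conjTranspose_mul, Matrix.conjTranspose_mul,
      Matrix.conjTranspose_conjTranspose, conjTranspose_gram_inv]
    calc _ = H * (toComplexMatrix V⁻¹ * toComplexMatrix V) * (Hᴴ * H)⁻¹ *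
          (toComplexMatrix V)ᴴ := by rw [toComplexMatrix_inv_mul hV, Matrix.mul_one]
      _ = _ := by simp only [Matrix.mul_assoc]

lemma norm_toLp_le (w : Fin N → ℂ) :
    ‖(WithLp.toLp 2 w : EuclideanSpace ℂ (Fin N))‖ ≤ N * ‖w‖ := by
  rw [EuclideanSpace.norm_eq]
  refine Real.sqrt_le_iff.2 ⟨by positivity, ?_⟩
  calc _ ≤ ∑ _i : Fin N, ‖w‖ ^ 2 := Finset.sum_le_sum fun i _ => by
        have := norm_le_pi_norm w i
        gcongr
    _ = N * ‖w‖ ^ 2 := by simp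
    _ ≤ (N : ℝ) ^ 2 * ‖w‖ ^ 2 := by
        gcongr
        exact_mod_cast Nat.le_self_pow two_ne_zero N
    _ = _ := by ring

lemma exists_short_of_nearestPoint_ne_zero {H : Matrix (Fin N) (Fin M) ℂ}
    {V : Matrix (Fin M) (Fin M) GaussianInt} (hV : IsUnit V.det) {D : ℝ}
    (hD : ∀ i, ‖column (toComplexMatrix V * pinv H)ᴴ i‖ *
      ‖column (H * toComplexMatrix V⁻¹) i‖ ≤ D) {w : Fin N → ℂ}
    (hw : nearestPoint ((toComplexMatrix V * pinv H) *ᵥ w) ≠ 0) :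
    ∃ z : Fin M → GaussianInt, z ≠ 0 ∧ ‖H *ᵥ toComplexVec z‖ ≤ 2 * N * D * ‖w‖ := by
  obtain ⟨j, hj⟩ := exists_half_le_norm_of_nearestPoint_ne_zero hw
  set P := toComplexMatrix V * pinv H
  have h1 : 1 / 2 ≤ ‖column Pᴴ j‖ * (N * ‖w‖) := by
    refine hj.trans ?_
    have : (P *ᵥ w) j = inner ℂ (column Pᴴ j) (WithLp.toLp 2 w : EuclideanSpace ℂ (Fin N)) := by
      simp [column, PiLp.inner_apply, Matrix.mulVec, dotProduct, mul_comm]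
    rw [this]
    refine (norm_inner_le_norm _ _).trans ?_
    gcongr
    exact norm_toLp_le w
  refine ⟨fun k => V⁻¹ k j, ?_, ?_⟩
  · intro h0
    have : (V * V⁻¹) j j = 0 := by
      rw [Matrix.mul_apply]
      exact Finset.sum_eq_zero fun k _ => by rw [congrFun h0 k]; simp
    rw [Matrix.mul_nonsing_inv _ hV, Matrix.one_apply_eq] at this
    exact one_ne_zero this
  · have h2 : ‖H *ᵥ toComplexVec fun k => V⁻¹ k j‖ ≤ ‖column (H * toComplexMatrix V⁻¹) j‖ := by
      refine (pi_norm_le_iff_of_nonneg (norm_nonneg _)).2 fun i => ?_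
      exact PiLp.norm_apply_le (column (H * toComplexMatrix V⁻¹) j) i
    have h3 := norm_nonneg (column (H * toComplexMatrix V⁻¹) j)
    have h4 := hD j
    calc _ ≤ ‖column (H * toComplexMatrix V⁻¹) j‖ * 1 := by rw [mul_one]; exact h2
      _ ≤ ‖column (H * toComplexMatrix V⁻¹) j‖ * (2 * (‖column Pᴴ j‖ * (N * ‖w‖))) := by
          gcongr; linarith
      _ = 2 * N * (‖column Pᴴ j‖ * ‖column (H * toComplexMatrix V⁻¹) j‖) * ‖w‖ := by ring
      _ ≤ _ := by gcongr

lemma one_le_norm_toComplex {z : GaussianInt} (hz : z ≠ 0) : 1 ≤ ‖GaussianInt.toComplex z‖ := by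
  have h1 : (1 : ℤ) ≤ z.norm := GaussianInt.norm_pos.2 hz
  have h2 : (1 : ℝ) ≤ ‖GaussianInt.toComplex z‖ ^ 2 := by
    rw [Complex.sq_norm, ← GaussianInt.intCast_real_norm]
    exact_mod_cast h1
  nlinarith [norm_nonneg (GaussianInt.toComplex z)]

/-- If a column `h` of `H` is short, every equalizer `V H⁻¹` amplifies the noise: it maps `h` to a
nonzero vector of Gaussian integers, so that one of its entries is large, and the corresponding
component of the filtered noise spreads over many Gaussian integers. -/
lemma noiseLaw_nearestPoint_eq_zero_le {H : Matrix (Fin N) (Fin M) ℂ}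
    (hH : LinearIndependent ℂ (column H)) {V : Matrix (Fin M) (Fin M) GaussianInt}
    (hV : IsUnit V.det) {k : Fin M} {s : ℝ} (hs : ∀ i, ‖H i k‖ ≤ s) {ρ : ℝ}
    (hρ : 0 < ρ) :
    noiseLaw N ρ {w | nearestPoint ((toComplexMatrix V * pinv H) *ᵥ w) = 0} ≤
      ENNReal.ofReal (2 * ρ * N ^ 2 * s ^ 2) := by
  set P := toComplexMatrix V * pinv H with hP
  have hPH : P * H = toComplexMatrix V := by
    rw [hP, Matrix.mul_assoc, pinv_mul_self hH, Matrix.mul_one]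
  obtain ⟨j, hj⟩ : ∃ j, V j k ≠ 0 := by
    by_contra! h
    have : (V⁻¹ * V) k k = 0 := by
      rw [Matrix.mul_apply]
      exact Finset.sum_eq_zero fun l _ => by rw [h l, mul_zero]
    rw [Matrix.nonsing_inv_mul _ hV, Matrix.one_apply_eq] at this
    exact one_ne_zero this
  have h1 : 1 ≤ ∑ i, ‖P j i‖ * s := by
    calc _ ≤ ‖toComplexMatrix V j k‖ := one_le_norm_toComplex hj
      _ = ‖∑ i, P j i * H i k‖ := by rw [← hPH, Matrix.mul_apply]
      _ ≤ ∑ i, ‖P j i * H i k‖ := norm_sum_le _ _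
      _ ≤ _ := Finset.sum_le_sum fun i _ => by
          rw [norm_mul]
          gcongr
          exact hs i
  have hne : Nonempty (Fin N) := by
    by_contra h
    rw [not_nonempty_iff] at h
    simp at h1
    linarith
  obtain ⟨i, hi⟩ := Finite.exists_max fun i => ‖P j i‖
  have hs0 : 0 ≤ s := (norm_nonneg _).trans (hs i)
  have h2 : 1 ≤ N * (‖P j i‖ * s) := by
    refine h1.trans
      ((Finset.sum_le_sum fun l _ => mul_le_mul_of_nonneg_right (hi l) hs0).trans_eq ?_)
    simp
  have hPi : P j i ≠ 0 := by
    intro h0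
    rw [h0] at h2
    simp at h2
    linarith
  have hv : (1 / ρ).toNNReal ≠ 0 := by
    rw [Ne, Real.toNNReal_eq_zero, not_le]; positivity
  refine le_trans (measure_mono ?_) ((pi_complexGaussian_linear_le hv (P j) hPi
    (zero_le_one (α := ℝ))).trans (ENNReal.ofReal_le_ofReal ?_))
  · intro w hw
    have := norm_le_one_of_nearestPoint_eq_zero hw j
    simpa [Matrix.mulVec, dotProduct, mul_comm] using this
  · rw [Real.coe_toNNReal _ (by positivity)]
    have hpos : 0 < ‖P j i‖ := norm_pos_iff.2 hPi
    have h3 : 1 ≤ (N * (‖P j i‖ * s)) ^ 2 := one_le_pow₀ h2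
    rw [div_le_iff₀ (by positivity)]
    calc _ ≤ 2 * 1 ^ 2 * (N * (‖P j i‖ * s)) ^ 2 := le_mul_of_one_le_right (by norm_num) h3
      _ = _ := by field_simp

end Decoding

/-! ### Bounds for the error probability -/

section ErrorProbability

open MeasureTheory ProbabilityTheory

variable {M N : ℕ}

/-- The decoder `dec` applies the equalizer `V H⁻¹` for a unimodular matrix `V = V H`, rounds, and
undoes the change of basis; and for each `i` the norms of the `i`-th row of `V H⁻¹` and the `i`-th
column of `H V⁻¹` have product at most `D`. Both types of LLL-aided decoding are of this form, with
`V = Uᴴ` and `V = U⁻¹` respectively. -/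
structure IsReducedRounding (D : ℝ)
    (dec : Matrix (Fin N) (Fin M) ℂ → (Fin N → ℂ) → (Fin M → GaussianInt))
    (V : Matrix (Fin N) (Fin M) ℂ → Matrix (Fin M) (Fin M) GaussianInt) : Prop where
  decode_eq : ∀ H y, dec H y =
    (V H)⁻¹ *ᵥ nearestPoint ((toComplexMatrix (V H) * pinv H) *ᵥ y)
  isUnit_det : ∀ H, IsUnit (V H).det
  dual_bound : ∀ H, LinearIndependent ℂ (column H) → ∀ i,
    ‖column (toComplexMatrix (V H) * pinv H)ᴴ i‖ * ‖column (H * toComplexMatrix (V H)⁻¹) i‖ ≤ D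

/-- The channel matrices and noise vectors for which the filtered noise is not rounded to zero. -/
def roundingError (V : Matrix (Fin N) (Fin M) ℂ → Matrix (Fin M) (Fin M) GaussianInt) :
    Set (Matrix (Fin N) (Fin M) ℂ × (Fin N → ℂ)) :=
  {Hw | nearestPoint ((toComplexMatrix (V Hw.1) * pinv Hw.1) *ᵥ Hw.2) ≠ 0}

lemma ae_linearIndependent_column (hMN : M ≤ N) (ρ : ℝ) :
    ∀ᵐ Hw ∂(channelLaw M N).prod (noiseLaw N ρ), LinearIndependent ℂ (column Hw.1) :=
  Measure.quasiMeasurePreserving_fst.ae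
    (p := fun H : Matrix (Fin N) (Fin M) ℂ => LinearIndependent ℂ (column H))
    (ae_iff.2 (channelLaw_not_linearIndependent hMN))

lemma IsReducedRounding.errorProb_eq {D : ℝ}
    {dec : Matrix (Fin N) (Fin M) ℂ → (Fin N → ℂ) → (Fin M → GaussianInt)}
    {V : Matrix (Fin N) (Fin M) ℂ → Matrix (Fin M) (Fin M) GaussianInt}
    (h : IsReducedRounding D dec V) (hMN : M ≤ N) (p : PMF (Fin M → GaussianInt)) (ρ : ℝ) :
    errorProb p dec ρ = ((channelLaw M N).prod (noiseLaw N ρ) (roundingError V)).toReal := by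
  have hx : ∀ x : Fin M → GaussianInt, (channelLaw M N).prod (noiseLaw N ρ)
      {Hw | dec Hw.1 (Hw.1 *ᵥ toComplexVec x + Hw.2) ≠ x} =
      (channelLaw M N).prod (noiseLaw N ρ) (roundingError V) := by
    intro x
    refine measure_congr ?_
    filter_upwards [ae_linearIndependent_column hMN ρ] with Hw hH
    refine propext (not_congr ?_)
    rw [h.decode_eq]
    exact inv_mulVec_nearestPoint_eq_iff hH (h.isUnit_det _) x _
  simp only [errorProb, hx, ENNReal.tsum_mul_right, p.tsum_coe, one_mul]

lemma measurableSet_exists_short (K : ℝ) :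
    MeasurableSet {Hw : Matrix (Fin N) (Fin M) ℂ × (Fin N → ℂ) |
      ∃ z : Fin M → GaussianInt, z ≠ 0 ∧ ‖Hw.1 *ᵥ toComplexVec z‖ ≤ K * ‖Hw.2‖} := by
  have : Countable GaussianInt :=
    Function.Injective.countable (f := fun z : GaussianInt => (z.re, z.im)) fun _ _ h =>
      Zsqrtd.ext (congrArg Prod.fst h) (congrArg Prod.snd h)
  suffices h : MeasurableSet (⋃ z : {z : Fin M → GaussianInt // z ≠ 0},
      {Hw : (Fin N → Fin M → ℂ) × (Fin N → ℂ) |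
        ‖fun i => ∑ k, Hw.1 i k * toComplexVec z.1 k‖ ≤ K * ‖Hw.2‖}) by
    convert! h using 1
    ext Hw
    refine ⟨fun ⟨z, hz, h⟩ => Set.mem_iUnion.2 ⟨⟨z, hz⟩, h⟩, fun h => ?_⟩
    obtain ⟨z, hz⟩ := Set.mem_iUnion.1 h
    exact ⟨z.1, z.2, hz⟩
  exact MeasurableSet.iUnion fun z => measurableSet_le (by fun_prop) (by fun_prop)

/-- A rounding error forces the lattice generated by the channel matrix to contain a nonzero
vector not much longer than the noise. -/
lemma IsReducedRounding.measure_roundingError_le {D : ℝ}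
    {dec : Matrix (Fin N) (Fin M) ℂ → (Fin N → ℂ) → (Fin M → GaussianInt)}
    {V : Matrix (Fin N) (Fin M) ℂ → Matrix (Fin M) (Fin M) GaussianInt}
    (h : IsReducedRounding D dec V) (hMN : M ≤ N) (ρ : ℝ) :
    (channelLaw M N).prod (noiseLaw N ρ) (roundingError V) ≤
      ∫⁻ w, channelLaw M N {H | ∃ z : Fin M → GaussianInt, z ≠ 0 ∧
        ‖H *ᵥ toComplexVec z‖ ≤ 2 * N * D * ‖w‖} ∂noiseLaw N ρ := by
  refine (measure_mono_ae ?_).trans_eq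
    (Measure.prod_apply_symm (measurableSet_exists_short (M := M) (N := N) (2 * N * D)))
  filter_upwards [ae_linearIndependent_column hMN ρ] with Hw hH hE
  exact exists_short_of_nearestPoint_ne_zero (h.isUnit_det _) (h.dual_bound _ hH) hE

lemma exists_upper_bound_of_lt (hMN : M < N) {D : ℝ} (hD : 0 ≤ D) :
    ∃ C : ℝ, 0 ≤ C ∧ ∀ ρ : ℝ, 0 < ρ →
      ∫⁻ w, channelLaw M N {H | ∃ z : Fin M → GaussianInt, z ≠ 0 ∧
        ‖H *ᵥ toComplexVec z‖ ≤ 2 * N * D * ‖w‖} ∂noiseLaw N ρ ≤ ENNReal.ofReal (C / ρ ^ N) := by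
  obtain ⟨C, hC, hmom⟩ := exists_lintegral_norm_pow_noiseLaw_le (by omega : 1 ≤ N) N
  set A : ℝ := 2 * 64 ^ M * 2 ^ N * (2 * N * D) ^ (2 * N)
  have hA : 0 ≤ A := by positivity
  refine ⟨A * C, by positivity, fun ρ hρ => ?_⟩
  calc _ ≤ ∫⁻ w, ENNReal.ofReal A * ENNReal.ofReal (‖w‖ ^ (2 * N)) ∂noiseLaw N ρ := by
        refine lintegral_mono fun w =>
          (channelLaw_exists_short_le_of_lt hMN (by positivity)).trans_eq ?_
        rw [← ENNReal.ofReal_mul hA]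
        congr 1
        simp only [A]
        ring
    _ = ENNReal.ofReal A * ∫⁻ w, ENNReal.ofReal (‖w‖ ^ (2 * N)) ∂noiseLaw N ρ :=
        lintegral_const_mul _ (by fun_prop)
    _ ≤ ENNReal.ofReal A * ENNReal.ofReal (C / ρ ^ N) := by gcongr; exact hmom ρ hρ
    _ = _ := by rw [← ENNReal.ofReal_mul hA, mul_div_assoc]

/-- For a square channel the number `L` of shells in the union bound is chosen of order `log ρ`, so
that `4 ^ (-L) ≤ ρ ^ (-N)`. -/
lemma exists_upper_bound_of_eq (hN : 1 ≤ N) {D : ℝ} (hD : 0 ≤ D) :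
    ∃ C : ℝ, 0 ≤ C ∧ ∀ ρ : ℝ, Real.exp 1 < ρ →
      ∫⁻ w, channelLaw N N {H | ∃ z : Fin N → GaussianInt, z ≠ 0 ∧
        ‖H *ᵥ toComplexVec z‖ ≤ 2 * N * D * ‖w‖} ∂noiseLaw N ρ ≤
      ENNReal.ofReal (C * Real.log ρ ^ (N + 1) / ρ ^ N) := by
  obtain ⟨C₁, hC₁, hmom₁⟩ := exists_lintegral_norm_pow_noiseLaw_le hN N
  obtain ⟨C₂, hC₂, hmom₂⟩ := exists_lintegral_norm_pow_noiseLaw_le hN 1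
  set A : ℝ := 64 ^ N * 2 ^ N * (2 * N * D) ^ (2 * N)
  set B : ℝ := 2 * N ^ 3 * (2 * N * D) ^ 2
  have hA : 0 ≤ A := by positivity
  have hB : 0 ≤ B := by positivity
  refine ⟨(N + 1) * A * C₁ + B * C₂, by positivity, fun ρ hρe => ?_⟩
  have hρ : 0 < ρ := (Real.exp_pos 1).trans hρe
  have hρ1 : 1 ≤ ρ := (Real.one_le_exp zero_le_one).trans hρe.le
  have hlog : 1 ≤ Real.log ρ := (Real.le_log_iff_exp_le hρ).2 hρe.le
  set L := ⌈N * Real.log ρ⌉₊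
  have hL : (L : ℝ) ≤ (N + 1) * Real.log ρ := by
    have : (L : ℝ) < N * Real.log ρ + 1 := Nat.ceil_lt_add_one (by positivity)
    linarith
  have hL4 : ρ ^ N ≤ 4 ^ L := by
    calc ρ ^ N = Real.exp (N * Real.log ρ) := by
          rw [mul_comm, Real.exp_mul, Real.exp_log hρ, Real.rpow_natCast]
      _ ≤ Real.exp L := Real.exp_le_exp.2 (Nat.le_ceil _)
      _ = Real.exp 1 ^ L := by rw [← Real.exp_nat_mul, mul_one]
      _ ≤ 4 ^ L := by
          gcongr
          linarith [Real.exp_one_lt_d9]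
  have hlogN : Real.log ρ ≤ Real.log ρ ^ (N + 1) := le_self_pow₀ hlog (by omega)
  calc _ ≤ ∫⁻ w, (ENNReal.ofReal (L * A) * ENNReal.ofReal (‖w‖ ^ (2 * N)) +
          ENNReal.ofReal (B / 4 ^ L) * ENNReal.ofReal (‖w‖ ^ (2 * 1))) ∂noiseLaw N ρ := by
        refine lintegral_mono fun w =>
          (channelLaw_exists_short_le L (by positivity)).trans_eq ?_
        rw [← ENNReal.ofReal_mul (by positivity), ← ENNReal.ofReal_mul (by positivity),
          ← ENNReal.ofReal_add (by positivity) (by positivity)]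
        congr 1
        simp only [A, B]
        ring
    _ = ENNReal.ofReal (L * A) * (∫⁻ w, ENNReal.ofReal (‖w‖ ^ (2 * N)) ∂noiseLaw N ρ) +
          ENNReal.ofReal (B / 4 ^ L) * ∫⁻ w, ENNReal.ofReal (‖w‖ ^ (2 * 1)) ∂noiseLaw N ρ := by
        rw [lintegral_add_left (by fun_prop), lintegral_const_mul _ (by fun_prop),
          lintegral_const_mul _ (by fun_prop)]
    _ ≤ ENNReal.ofReal (L * A) * ENNReal.ofReal (C₁ / ρ ^ N) +
          ENNReal.ofReal (B / 4 ^ L) * ENNReal.ofReal (C₂ / ρ ^ 1) := by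
        gcongr
        · exact hmom₁ ρ hρ
        · exact hmom₂ ρ hρ
    _ = ENNReal.ofReal (L * A * (C₁ / ρ ^ N) + B / 4 ^ L * (C₂ / ρ ^ 1)) := by
        rw [← ENNReal.ofReal_mul (by positivity), ← ENNReal.ofReal_mul (by positivity),
          ← ENNReal.ofReal_add (by positivity) (by positivity)]
    _ ≤ _ := by
        refine ENNReal.ofReal_le_ofReal ?_
        calc _ ≤ (N + 1) * Real.log ρ ^ (N + 1) * A * (C₁ / ρ ^ N) +
              B / ρ ^ N * (C₂ * Real.log ρ ^ (N + 1)) := by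
              gcongr
              · exact hL.trans (by gcongr)
              · rw [pow_one]
                calc C₂ / ρ ≤ C₂ := div_le_self hC₂ hρ1
                  _ ≤ _ := le_mul_of_one_le_right hC₂ (hlog.trans hlogN)
          _ = _ := by ring

/-- With probability of order `ρ ^ (-N)` the entries of a column of the channel matrix are at most
of order `ρ ^ (-1/2)`, and then rounding fails with probability at least `1 / 2`. -/
lemma exists_lower_bound (hM : 1 ≤ M) (hMN : M ≤ N) :
    ∃ c : ℝ, 0 < c ∧ ∀ V : Matrix (Fin N) (Fin M) ℂ → Matrix (Fin M) (Fin M) GaussianInt,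
      (∀ H, IsUnit (V H).det) → ∀ ρ : ℝ, 1 ≤ ρ →
      ENNReal.ofReal (c / ρ ^ N) ≤ (channelLaw M N).prod (noiseLaw N ρ) (roundingError V) := by
  obtain ⟨d, hd, hball⟩ := exists_le_complexGaussian_ball
  have hN : (1 : ℝ) ≤ N := by exact_mod_cast hM.trans hMN
  have hN0 : (N : ℝ) ≠ 0 := by positivity
  refine ⟨1 / 2 * (d / (16 * N ^ 2)) ^ N, by positivity, fun V hV ρ hρ => ?_⟩
  have hρ0 : 0 < ρ := by linarith
  set s : ℝ := 1 / (4 * N * Real.sqrt ρ)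
  have hs0 : 0 ≤ s := by positivity
  have hsq : s ^ 2 = 1 / (16 * N ^ 2 * ρ) := by
    simp only [s]
    rw [div_pow, mul_pow, mul_pow, Real.sq_sqrt hρ0.le]
    norm_num
  have hs1 : s ≤ 1 := by
    have h1 : 1 ≤ Real.sqrt ρ := Real.one_le_sqrt.2 hρ
    rw [div_le_one (by positivity)]
    nlinarith
  let k : Fin M := ⟨0, hM⟩
  set S : Set (Matrix (Fin N) (Fin M) ℂ) := {H | ∀ i, ‖H i k‖ ≤ 2 * s} with hS
  have hSeq : S = Set.univ.pi fun _ : Fin N => {h : Fin M → ℂ | ‖h k‖ ≤ 2 * s} := by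
    ext H
    exact ⟨fun h i _ => h i, fun h i => h i trivial⟩
  have hrow : MeasurableSet {h : Fin M → ℂ | ‖h k‖ ≤ 2 * s} :=
    measurableSet_le (by fun_prop) measurable_const
  have hSmeas : MeasurableSet S := by
    rw [hSeq]
    exact MeasurableSet.univ_pi fun _ => hrow
  have hSmass : ENNReal.ofReal ((d * s ^ 2) ^ N) ≤ channelLaw M N S := by
    rw [hSeq]
    change _ ≤ (Measure.pi fun _ : Fin N => Measure.pi fun _ : Fin M => complexGaussian 1) _
    rw [Measure.pi_pi, Finset.prod_const, Finset.card_univ, Fintype.card_fin,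
      ENNReal.ofReal_pow (by positivity)]
    gcongr
    refine (hball s hs0 hs1).trans_eq ?_
    exact ((measurePreserving_eval (fun _ : Fin M => complexGaussian 1) k).measure_preimage
      (measurableSet_le (f := fun z : ℂ => ‖z‖) (by fun_prop)
        measurable_const).nullMeasurableSet).symm
  have hhalf : ∀ H ∈ S, LinearIndependent ℂ (column H) →
      ENNReal.ofReal (1 / 2) ≤ noiseLaw N ρ (Prod.mk H ⁻¹' roundingError V) := by
    intro H hHS hH
    have h1 : noiseLaw N ρ (Prod.mk H ⁻¹' roundingError V)ᶜ ≤ ENNReal.ofReal (1 / 2) := by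
      have hset : (Prod.mk H ⁻¹' roundingError V)ᶜ =
          {w | nearestPoint ((toComplexMatrix (V H) * pinv H) *ᵥ w) = 0} := by
        ext w
        simp [roundingError]
      rw [hset]
      refine (noiseLaw_nearestPoint_eq_zero_le hH (hV H) hHS hρ0).trans_eq ?_
      congr 1
      rw [mul_pow, hsq]
      field_simp
      norm_num
    have h2 : (1 : ℝ≥0∞) ≤ noiseLaw N ρ (Prod.mk H ⁻¹' roundingError V) +
        ENNReal.ofReal (1 / 2) := by
      refine le_trans ?_ (add_le_add_right h1 _)
      rw [← measure_univ (μ := noiseLaw N ρ),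
        ← Set.union_compl_self (Prod.mk H ⁻¹' roundingError V)]
      exact measure_union_le _ _
    rw [show (1 : ℝ≥0∞) = ENNReal.ofReal (1 / 2) + ENNReal.ofReal (1 / 2) by
      rw [← ENNReal.ofReal_add (by norm_num) (by norm_num)]; norm_num] at h2
    exact (ENNReal.add_le_add_iff_right ENNReal.ofReal_ne_top).1 h2
  -- No measurability of `V` is assumed, hence the measurable hull.
  set T := toMeasurable ((channelLaw M N).prod (noiseLaw N ρ)) (roundingError V)
  have hT : MeasurableSet T := measurableSet_toMeasurable _ _
  rw [← measure_toMeasurable, Measure.prod_apply hT]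
  calc _ = ENNReal.ofReal (1 / 2) * ENNReal.ofReal ((d * s ^ 2) ^ N) := by
        rw [← ENNReal.ofReal_mul (by norm_num), hsq]
        congr 1
        rw [mul_div_assoc, ← div_pow]
        congr 2
        field_simp
    _ ≤ ENNReal.ofReal (1 / 2) * channelLaw M N S := by gcongr
    _ = ∫⁻ _ in S, ENNReal.ofReal (1 / 2) ∂channelLaw M N := by rw [setLIntegral_const]
    _ ≤ ∫⁻ H in S, noiseLaw N ρ (Prod.mk H ⁻¹' T) ∂channelLaw M N := by
        refine setLIntegral_mono_ae (measurable_measure_prodMk_left hT).aemeasurable ?_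
        filter_upwards [ae_iff.2 (channelLaw_not_linearIndependent hMN)] with H hH hHS
        exact (hhalf H hHS hH).trans (measure_mono (Set.preimage_mono (subset_toMeasurable _ _)))
    _ ≤ _ := setLIntegral_le_lintegral _ _

lemma hasDiversity_of_bounds {P : ℝ → ℝ} {c C : ℝ} (hc : 0 < c) (hC : 0 < C) (m N : ℕ)
    (hlow : ∀ ρ, Real.exp 1 < ρ → c / ρ ^ N ≤ P ρ)
    (hup : ∀ ρ, Real.exp 1 < ρ → P ρ ≤ C * Real.log ρ ^ m / ρ ^ N) : HasDiversity P N := by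
  have hlog := Real.tendsto_log_atTop
  have hl1 : Filter.Tendsto (fun ρ => N - Real.log C / Real.log ρ -
      m * (Real.log (Real.log ρ) / Real.log ρ)) Filter.atTop (nhds N) := by
    have h1 := hlog.const_div_atTop (Real.log C)
    have h2 : Filter.Tendsto (fun ρ => Real.log (Real.log ρ) / Real.log ρ) Filter.atTop
        (nhds 0) := (Real.isLittleO_log_id_atTop.tendsto_div_nhds_zero).comp hlog
    simpa using (h1.const_sub (N : ℝ)).sub (h2.const_mul (m : ℝ))
  have hl2 : Filter.Tendsto (fun ρ => N - Real.log c / Real.log ρ) Filter.atTop (nhds (N : ℝ)) := by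
    simpa using (hlog.const_div_atTop (Real.log c)).const_sub (N : ℝ)
  refine tendsto_of_tendsto_of_tendsto_of_le_of_le' hl1 hl2 ?_ ?_
  · filter_upwards [Filter.eventually_gt_atTop (Real.exp 1)] with ρ hρe
    have hρ : 0 < ρ := (Real.exp_pos 1).trans hρe
    have hl : 1 < Real.log ρ := (Real.lt_log_iff_exp_lt hρ).2 hρe
    have hl0 : 0 < Real.log ρ := by linarith
    have hP : 0 < P ρ := lt_of_lt_of_le (by positivity) (hlow ρ hρe)
    have h := Real.log_le_log hP (hup ρ hρe)
    rw [Real.log_div (by positivity) (by positivity), Real.log_mul (by positivity) (by positivity),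
      Real.log_pow, Real.log_pow] at h
    rw [le_div_iff₀ hl0]
    have : (N - Real.log C / Real.log ρ - m * (Real.log (Real.log ρ) / Real.log ρ)) * Real.log ρ =
        N * Real.log ρ - Real.log C - m * Real.log (Real.log ρ) := by field_simp
    linarith
  · filter_upwards [Filter.eventually_gt_atTop (Real.exp 1)] with ρ hρe
    have hρ : 0 < ρ := (Real.exp_pos 1).trans hρe
    have hl : 1 < Real.log ρ := (Real.lt_log_iff_exp_lt hρ).2 hρe
    have hl0 : 0 < Real.log ρ := by linarith
    have h := Real.log_le_log (by positivity) (hlow ρ hρe)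
    rw [Real.log_div (by positivity) (by positivity), Real.log_pow] at h
    rw [div_le_iff₀ hl0]
    have : (N - Real.log c / Real.log ρ) * Real.log ρ = N * Real.log ρ - Real.log c := by
      field_simp
    linarith

theorem exists_errorProb_bounds (hM : 1 ≤ M) (hMN : M ≤ N) {D : ℝ} (hD : 0 ≤ D) :
    ∃ C : ℝ, 0 < C ∧ ∀ (p : PMF (Fin M → GaussianInt))
      (dec : Matrix (Fin N) (Fin M) ℂ → (Fin N → ℂ) → (Fin M → GaussianInt))
      (V : Matrix (Fin N) (Fin M) ℂ → Matrix (Fin M) (Fin M) GaussianInt),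
      IsReducedRounding D dec V →
        HasDiversity (errorProb p dec) N ∧
        (M < N → ∀ ρ : ℝ, 0 < ρ → errorProb p dec ρ ≤ C / ρ ^ N) ∧
        (M = N → ∀ ρ : ℝ, Real.exp 1 < ρ →
          errorProb p dec ρ ≤ C * Real.log ρ ^ (N + 1) / ρ ^ N) := by
  obtain ⟨c, hc, hlow⟩ := exists_lower_bound hM hMN
  have hlow' : ∀ (p : PMF (Fin M → GaussianInt))
      (dec : Matrix (Fin N) (Fin M) ℂ → (Fin N → ℂ) → (Fin M → GaussianInt))
      (V : Matrix (Fin N) (Fin M) ℂ → Matrix (Fin M) (Fin M) GaussianInt),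
      IsReducedRounding D dec V → ∀ ρ, Real.exp 1 < ρ → c / ρ ^ N ≤ errorProb p dec ρ := by
    intro p dec V h ρ hρ
    rw [h.errorProb_eq hMN]
    exact (ENNReal.ofReal_le_iff_le_toReal (measure_ne_top _ _)).1
      (hlow V h.isUnit_det ρ ((Real.one_le_exp zero_le_one).trans hρ.le))
  rcases hMN.lt_or_eq with hlt | rfl
  · obtain ⟨C, hC, hup⟩ := exists_upper_bound_of_lt hlt hD
    refine ⟨C + 1, by positivity, fun p dec V h => ?_⟩
    have hup' : ∀ ρ : ℝ, 0 < ρ → errorProb p dec ρ ≤ (C + 1) / ρ ^ N := by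
      intro ρ hρ
      rw [h.errorProb_eq hMN]
      refine ENNReal.toReal_le_of_le_ofReal (by positivity)
        ((h.measure_roundingError_le hMN ρ).trans ((hup ρ hρ).trans
          (ENNReal.ofReal_le_ofReal ?_)))
      gcongr
      linarith
    refine ⟨?_, fun _ => hup', fun heq => absurd heq hlt.ne⟩
    refine hasDiversity_of_bounds hc (by positivity : 0 < C + 1) 0 N (hlow' p dec V h) ?_
    intro ρ hρ
    simpa using hup' ρ ((Real.exp_pos 1).trans hρ)
  · obtain ⟨C, hC, hup⟩ := exists_upper_bound_of_eq hM hD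
    refine ⟨C + 1, by positivity, fun p dec V h => ?_⟩
    have hup' : ∀ ρ : ℝ, Real.exp 1 < ρ →
        errorProb p dec ρ ≤ (C + 1) * Real.log ρ ^ (M + 1) / ρ ^ M := by
      intro ρ hρe
      have hρ : 0 < ρ := (Real.exp_pos 1).trans hρe
      have hl : 1 < Real.log ρ := (Real.lt_log_iff_exp_lt hρ).2 hρe
      rw [h.errorProb_eq le_rfl]
      refine ENNReal.toReal_le_of_le_ofReal (by positivity)
        ((h.measure_roundingError_le le_rfl ρ).trans ((hup ρ hρe).trans
          (ENNReal.ofReal_le_ofReal ?_)))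
      gcongr
      linarith
    exact ⟨hasDiversity_of_bounds hc (by positivity : 0 < C + 1) (M + 1) M (hlow' p dec V h) hup',
      fun hlt => absurd hlt (lt_irrefl _), fun _ => hup'⟩

lemma IsLLLReduction.isReducedRounding_decodeI {η : ℝ} (hη : 1 / 2 < η) (hη' : η < 1)
    {U : Matrix (Fin N) (Fin M) ℂ → GL (Fin M) GaussianInt} (hU : IsLLLReduction η invHerm U) :
    IsReducedRounding (dualConst M η) (decodeI U) fun H => (U H).valᴴ where
  decode_eq := decodeI_eq U
  isUnit_det H := by
    rw [Matrix.det_conjTranspose]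
    exact (isUnit_det_val (U H)).star
  dual_bound H hH i := by
    have hdet : IsUnit ((U H).valᴴ).det := by
      rw [Matrix.det_conjTranspose]
      exact (isUnit_det_val (U H)).star
    refine dual_bound_of_reduced_rows hη hη' hH hdet ?_ i
    have h := hU.reduced H hH
    rwa [invHerm, ← Matrix.conjTranspose_conjTranspose (toComplexMatrix (U H).val),
      ← Matrix.conjTranspose_mul, ← toComplexMatrix_conjTranspose] at h

lemma IsLLLReduction.isReducedRounding_decodeII {η : ℝ} (hη : 1 / 2 < η) (hη' : η < 1)
    {U : Matrix (Fin N) (Fin M) ℂ → GL (Fin M) GaussianInt}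
    (hU : IsLLLReduction η (fun H => H) U) :
    IsReducedRounding (dualConst M η) (decodeII U) fun H => (U H).val⁻¹ where
  decode_eq := decodeII_eq U
  isUnit_det H := Matrix.isUnit_nonsing_inv_det _ (isUnit_det_val (U H))
  dual_bound H hH i := by
    refine dual_bound_of_reduced_columns hη hη' hH
      (Matrix.isUnit_nonsing_inv_det _ (isUnit_det_val (U H))) ?_ i
    rw [Matrix.nonsing_inv_nonsing_inv _ (isUnit_det_val _)]
    exact hU.reduced H hH

end ErrorProbability

end LLLDecoding

end

theorem theorem2 (M N : ℕ) (hM : 1 ≤ M) (hMN : M ≤ N) (η : ℝ) (hη : 1 / 2 < η) (hη' : η < 1) :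
    ∃ C : ℝ, 0 < C ∧ ∀ p : PMF (Fin M → GaussianInt),
      (∀ U : Matrix (Fin N) (Fin M) ℂ → GL (Fin M) GaussianInt,
        LLLDecoding.IsLLLReduction η LLLDecoding.invHerm U →
          LLLDecoding.HasDiversity (LLLDecoding.errorProb p (LLLDecoding.decodeI U)) N ∧
          (M < N → ∀ ρ : ℝ, 0 < ρ →
            LLLDecoding.errorProb p (LLLDecoding.decodeI U) ρ ≤ C / ρ ^ N) ∧
          (M = N → ∀ ρ : ℝ, Real.exp 1 < ρ →
            LLLDecoding.errorProb p (LLLDecoding.decodeI U) ρ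
              ≤ C * Real.log ρ ^ (N + 1) / ρ ^ N)) ∧
      (∀ U : Matrix (Fin N) (Fin M) ℂ → GL (Fin M) GaussianInt,
        LLLDecoding.IsLLLReduction η (fun H => H) U →
          LLLDecoding.HasDiversity (LLLDecoding.errorProb p (LLLDecoding.decodeII U)) N ∧
          (M < N → ∀ ρ : ℝ, 0 < ρ →
            LLLDecoding.errorProb p (LLLDecoding.decodeII U) ρ ≤ C / ρ ^ N) ∧
          (M = N → ∀ ρ : ℝ, Real.exp 1 < ρ →
            LLLDecoding.errorProb p (LLLDecoding.decodeII U) ρ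
              ≤ C * Real.log ρ ^ (N + 1) / ρ ^ N)) := by
  obtain ⟨C, hC, h⟩ := LLLDecoding.exists_errorProb_bounds hM hMN
    (LLLDecoding.dualConst_nonneg M hη)
  exact ⟨C, hC, fun p =>
    ⟨fun U hU => h p _ _ (hU.isReducedRounding_decodeI hη hη'),
      fun U hU => h p _ _ (hU.isReducedRounding_decodeII hη hη')⟩⟩
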